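/- Let $\mathbb{K}$ be an algebraically closed field and $V$ a $\mathbb{K}$-vector space of finite positive dimension. A linear map $A:V\to V$ is diagonalizable if $V$ is spanned by its eigenspaces. A tridiagonal pair on $V$ is an ordered pair of diagonalizable linear maps $A,A^*:V\to V$ such that the (nonzero) eigenspaces of $A$ can be ordered $V_0,\dots,V_d$ with $A^*V_i\subseteq V_{i-1}+V_i+V_{i+1}$ for all $i$ (where $V_{-1}=V_{d+1}=0$), the eigenspaces of $A^*$ can be ordered $V^*_0,\dots,V^*_\delta$ with $AV^*_i\subseteq V^*_{i-1}+V^*_i+V^*_{i+1}$ for all $i$ (where $V^*_{-1}=V^*_{\delta+1}=0$), and no subspace $W$ with $W\neq 0$, $W\neq V$ satisfies $AW\subseteq W$ and $A^*W\subseteq W$; such orderings are called standard. A tridiagonal system of diameter $d$ on $V$ is a sequence $\Phi=(A;\{E_i\}_{i=0}^d;A^*;\{E_i^*\}_{i=0}^d)$ where $A,A^*$ is a tridiagonal pair on $V$ and $E_0,\dots,E_d$ (resp. $E^*_0,\dots,E^*_d$) are the projections onto the eigenspaces of $A$ (resp. $A^*$), taken in a standard ordering, along the sum of the other eigenspaces.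 Let $\Phi$ be a tridiagonal system on $V$ of diameter $d\ge 1$ that has $q$-Racah type: there are nonzero $q,a,b\in\mathbb{K}$ with $q^4\neq 1$ such that for $0\le i\le d$ the eigenvalue of $A$ associated with $E_i$ is $aq^{d-2i}+a^{-1}q^{2i-d}$ and the eigenvalue of $A^*$ associated with $E^*_i$ is $bq^{d-2i}+b^{-1}q^{2i-d}$. For $0\le i\le d$ put $$U_i=(E_0^*V+\cdots+E_i^*V)\cap(E_iV+\cdots+E_dV),\qquad U_i^{\Downarrow}=(E_0^*V+\cdots+E_i^*V)\cap(E_0V+\cdots+E_{d-i}V),$$ and for $0\le i\le d/2$ put $K_i=(E_0^*V+\cdots+E_i^*V)\cap(E_iV+\cdots+E_{d-i}V)$. Then there are unique linear maps $K,B:V\to V$ such that $(K-q^{d-2i}I)U_i=0$ and $(B-q^{d-2i}I)U_i^{\Downarrow}=0$ for $0\le i\le d$; both are invertible. With $R=A-aK-a^{-1}K^{-1}$, there is a unique linear map $\psi:V\to V$ such that $\psi R-R\psi=(q-q^{-1})(K-K^{-1})$ and $\psi K_i=0$ for $0\le i\le d/2$. Moreover: 1. $\psi$ is nilpotent, with $\psi^{d+1}=0$,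 and each of $I-aq\psi$, $I-a^{-1}q\psi$, $I-aq^{-1}\psi$, $I-a^{-1}q^{-1}\psi$ is invertible. 2. $$BK^{-1}=(I-aq\psi)(I-a^{-1}q\psi)^{-1},\qquad KB^{-1}=(I-a^{-1}q\psi)(I-aq\psi)^{-1},$$ $$K^{-1}B=(I-aq^{-1}\psi)(I-a^{-1}q^{-1}\psi)^{-1},\qquad B^{-1}K=(I-a^{-1}q^{-1}\psi)(I-aq^{-1}\psi)^{-1}.$$ 3. Each of $BK^{-1}$, $KB^{-1}$, $K^{-1}B$, $B^{-1}K$ is a polynomial in $\psi$ with coefficients in $\mathbb{K}$. -/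

import Mathlib

/-- `A` is diagonalizable: `V` is spanned by the eigenspaces of `A`. -/
def IsDiagonalizableEnd {𝕂 V : Type*} [Field 𝕂] [AddCommGroup V] [Module 𝕂 V]
    (A : Module.End 𝕂 V) : Prop :=
  ⨆ θ : 𝕂, A.eigenspace θ = ⊤

/-- `W 0, …, W d` is an ordering of the (nonzero) eigenspaces of `A`: every eigenspace occurs
exactly once, and nothing else occurs. -/
def IsEigenspaceOrdering {𝕂 V : Type*} [Field 𝕂] [AddCommGroup V] [Module 𝕂 V]
    (A : Module.End 𝕂 V) {d : ℕ} (W : Fin (d + 1) → Submodule 𝕂 V) : Prop :=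
  Function.Injective W ∧
    Set.range W = {S : Submodule 𝕂 V | S ≠ ⊥ ∧ ∃ θ : 𝕂, S = A.eigenspace θ}

/-- `W 0, …, W d` is a standard ordering of the eigenspaces of `A` with respect to `A'`:
`A' W_i ⊆ W_{i-1} + W_i + W_{i+1}`, where `W_{-1} = W_{d+1} = 0`. -/
def IsStandardOrdering {𝕂 V : Type*} [Field 𝕂] [AddCommGroup V] [Module 𝕂 V]
    (A A' : Module.End 𝕂 V) {d : ℕ} (W : Fin (d + 1) → Submodule 𝕂 V) : Prop :=
  IsEigenspaceOrdering A W ∧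
    ∀ i : Fin (d + 1), (W i).map A' ≤
      ⨆ j : Fin (d + 1), ⨆ _ : (j : ℕ) ≤ (i : ℕ) + 1 ∧ (i : ℕ) ≤ (j : ℕ) + 1, W j

/-- `A, A'` is a tridiagonal pair on `V` (for `V` of finite positive dimension). -/
structure IsTridiagonalPair {𝕂 V : Type*} [Field 𝕂] [AddCommGroup V] [Module 𝕂 V]
    (A A' : Module.End 𝕂 V) : Prop where
  diagonalizable : IsDiagonalizableEnd A
  diagonalizable' : IsDiagonalizableEnd A'
  exists_standard : ∃ (d : ℕ) (W : Fin (d + 1) → Submodule 𝕂 V), IsStandardOrdering A A' W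
  exists_standard' : ∃ (δ : ℕ) (W : Fin (δ + 1) → Submodule 𝕂 V), IsStandardOrdering A' A W
  irreducible : ∀ W : Submodule 𝕂 V, W.map A ≤ W → W.map A' ≤ W → W = ⊥ ∨ W = ⊤

/-- `E 0, …, E d` is a standard ordering of the primitive idempotents of `A` with respect to `A'`:
there is a standard ordering `W 0, …, W d` of the eigenspaces of `A` such that
`(E_i - I) W_i = 0` and `E_i W_j = 0` for `j ≠ i`. -/
def IsStandardIdempotentOrdering {𝕂 V : Type*} [Field 𝕂] [AddCommGroup V] [Module 𝕂 V]
    (A A' : Module.End 𝕂 V) {d : ℕ} (E : Fin (d + 1) → Module.End 𝕂 V) : Prop :=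
  ∃ W : Fin (d + 1) → Submodule 𝕂 V, IsStandardOrdering A A' W ∧
    ∀ i : Fin (d + 1), (∀ v ∈ W i, E i v = v) ∧ ∀ j : Fin (d + 1), j ≠ i → ∀ v ∈ W j, E i v = 0

/-- A tridiagonal system `(A; {E_i}; A^*; {E_i^*})` of diameter `d` on `V`. -/
structure TDSystem (𝕂 V : Type*) [Field 𝕂] [AddCommGroup V] [Module 𝕂 V] (d : ℕ) where
  A : Module.End 𝕂 V
  E : Fin (d + 1) → Module.End 𝕂 V
  Astar : Module.End 𝕂 V
  Estar : Fin (d + 1) → Module.End 𝕂 V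
  isTridiagonalPair : IsTridiagonalPair A Astar
  standard : IsStandardIdempotentOrdering A Astar E
  standard_star : IsStandardIdempotentOrdering Astar A Estar

namespace TDSystem

variable {𝕂 V : Type*} [Field 𝕂] [AddCommGroup V] [Module 𝕂 V] {d : ℕ}

/-- `Φ` has `q`-Racah type with parameters `q, a, b`: the eigenvalue of `A` associated with `E_i`
is `a q^{d-2i} + a⁻¹ q^{2i-d}`, and the eigenvalue of `A^*` associated with `E_i^*` is
`b q^{d-2i} + b⁻¹ q^{2i-d}`. -/
structure IsQRacah (Φ : TDSystem 𝕂 V d) (q a b : 𝕂) : Prop where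
  q_ne_zero : q ≠ 0
  a_ne_zero : a ≠ 0
  b_ne_zero : b ≠ 0
  q_pow_four_ne_one : q ^ 4 ≠ 1
  eigenvalue : ∀ i : Fin (d + 1), Φ.A * Φ.E i =
    (a * q ^ ((d : ℤ) - 2 * (i : ℤ)) + a⁻¹ * q ^ (2 * (i : ℤ) - (d : ℤ))) • Φ.E i
  eigenvalue_star : ∀ i : Fin (d + 1), Φ.Astar * Φ.Estar i =
    (b * q ^ ((d : ℤ) - 2 * (i : ℤ)) + b⁻¹ * q ^ (2 * (i : ℤ) - (d : ℤ))) • Φ.Estar i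

/-- `U_i = (E_0^* V + ⋯ + E_i^* V) ∩ (E_i V + ⋯ + E_d V)`. -/
def U (Φ : TDSystem 𝕂 V d) (i : Fin (d + 1)) : Submodule 𝕂 V :=
  (⨆ j : Fin (d + 1), ⨆ _ : j ≤ i, LinearMap.range (Φ.Estar j)) ⊓
    ⨆ j : Fin (d + 1), ⨆ _ : i ≤ j, LinearMap.range (Φ.E j)

/-- `U_i^⇓ = (E_0^* V + ⋯ + E_i^* V) ∩ (E_0 V + ⋯ + E_{d-i} V)`. -/
def Udd (Φ : TDSystem 𝕂 V d) (i : Fin (d + 1)) : Submodule 𝕂 V :=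
  (⨆ j : Fin (d + 1), ⨆ _ : j ≤ i, LinearMap.range (Φ.Estar j)) ⊓
    ⨆ j : Fin (d + 1), ⨆ _ : (j : ℕ) + (i : ℕ) ≤ d, LinearMap.range (Φ.E j)

/-- `K_i = (E_0^* V + ⋯ + E_i^* V) ∩ (E_i V + ⋯ + E_{d-i} V)`, used for `0 ≤ i ≤ d/2`. -/
def Ksub (Φ : TDSystem 𝕂 V d) (i : Fin (d + 1)) : Submodule 𝕂 V :=
  (⨆ j : Fin (d + 1), ⨆ _ : j ≤ i, LinearMap.range (Φ.Estar j)) ⊓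
    ⨆ j : Fin (d + 1), ⨆ _ : i ≤ j ∧ (j : ℕ) + (i : ℕ) ≤ d, LinearMap.range (Φ.E j)

/-- The defining property of the map `K`: `(K - q^{d-2i} I) U_i = 0` for `0 ≤ i ≤ d`. -/
def IsK (Φ : TDSystem 𝕂 V d) (q : 𝕂) (K : Module.End 𝕂 V) : Prop :=
  ∀ i : Fin (d + 1), ∀ u ∈ Φ.U i, K u = q ^ ((d : ℤ) - 2 * (i : ℤ)) • u

/-- The defining property of the map `B`: `(B - q^{d-2i} I) U_i^⇓ = 0` for `0 ≤ i ≤ d`. -/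
def IsB (Φ : TDSystem 𝕂 V d) (q : 𝕂) (B : Module.End 𝕂 V) : Prop :=
  ∀ i : Fin (d + 1), ∀ u ∈ Φ.Udd i, B u = q ^ ((d : ℤ) - 2 * (i : ℤ)) • u

/-- The raising map `R = A - a K - a⁻¹ K⁻¹`. -/
def R (Φ : TDSystem 𝕂 V d) (a : 𝕂) (K : (Module.End 𝕂 V)ˣ) : Module.End 𝕂 V :=
  Φ.A - a • (K : Module.End 𝕂 V) - a⁻¹ • ((K⁻¹ : (Module.End 𝕂 V)ˣ) : Module.End 𝕂 V)

/-- The defining property of the double lowering map `ψ`: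
`ψ R - R ψ = (q - q⁻¹)(K - K⁻¹)` and `ψ K_i = 0` for `0 ≤ i ≤ d/2`. -/
def IsPsi (Φ : TDSystem 𝕂 V d) (q a : 𝕂) (K : (Module.End 𝕂 V)ˣ) (ψ : Module.End 𝕂 V) : Prop :=
  ψ * Φ.R a K - Φ.R a K * ψ =
      (q - q⁻¹) • ((K : Module.End 𝕂 V) - ((K⁻¹ : (Module.End 𝕂 V)ˣ) : Module.End 𝕂 V)) ∧
    ∀ i : Fin (d + 1), 2 * (i : ℕ) ≤ d → ∀ v ∈ Φ.Ksub i, ψ v = 0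

end TDSystem

/-!
The sums `lo n = E_0^*V + ⋯ + E_{n-1}^*V` and `hi n = E_nV + ⋯ + E_dV` satisfy
`(A - θ_n) hi n ⊆ hi (n+1)`, `A lo n ⊆ lo (n+1)`, and dually for `A^*`. Hence the sum over `n` of
`lo n ∩ hi n`, and that of `U_n = lo (n+1) ∩ hi n`, are stable under `A` and `A^*`; by irreducibility
the first is zero and the second is `V` (`lo_inf_hi`, `iSup_split`). So `V` is the direct sum of the
`U_n` and `K` exists. Applied to the system `Φ^⇓` with the `E_i` in reversed order, which replaces
`a` by `a⁻¹`, the same argument gives `B`.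

On `U_i` the raising map `R` acts as `A - θ_i`, so the kernel of `R^m` on `U_i` is
`U_i ∩ (E_0V + ⋯ + E_{i+m-1}V)`. For `m = d-2i+1` this is `K_i`; for `m = d-2i` it is zero, by the
vanishing of `lo (i+1) ∩ hi (i+1)` in `Φ^⇓`. Since `dim U_i = dim U_{d-i}` (`finrank_split_symm`), the
map `R^{d-2i} : U_i → U_{d-i}` is a bijection, and as in the Lefschetz decomposition `V` is the direct
sum of the spaces `R^j K_i`, `0 ≤ j ≤ d-2i` (`le_of_primitive_le`, `exists_lowering`). In these terms
`ψ` is forced to send `R^j p`, for `p ∈ K_i`, to an explicit multiple of `R^{j-1} p` (`psiCoeff`),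
which gives its existence and uniqueness, nilpotency, and `Kψ = q²ψK`.

Finally let `X = (1 - aqψ)(1 - a⁻¹qψ)⁻¹K`. The relations between `A`, `K` and `ψ` imply
`qXA - q⁻¹AX = (q - q⁻¹)(a⁻¹X² + a)` (`qWeyl_of_psi`), which is the relation that characterises how `B`
interacts with `A`: it makes `A - θ_{d-k}` send the `q^{d-2k}`-eigenspace of `X` into the
`q^{d-2k-2}`-eigenspace. Both `X` and `B` act on `K_i` as `q^{d-2i}`, and the `K_i` generate `V` under
`A`, so `X = B` (`isB_of_qWeyl`). The other formulas follow by inversion and by conjugation with `K`.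
-/

/-! ### Graded spaces with a raising operator -/

/-- A linear map on `V` may be prescribed along a finite family of linear maps into `V` that is
jointly injective. -/
theorem LinearMap.exists_comp_eq_of_sum_injective {𝕂 V ι : Type*} [Field 𝕂] [AddCommGroup V]
    [Module 𝕂 V] [Fintype ι] {P : ι → Submodule 𝕂 V} (g h : ∀ i, P i →ₗ[𝕂] V)
    (hg : ∀ x : ∀ i, P i, ∑ i, g i (x i) = 0 → x = 0) :
    ∃ ψ : Module.End 𝕂 V, ∀ i (x : P i), ψ (g i x) = h i x := by
  classical
  let G : (∀ i, P i) →ₗ[𝕂] V := ∑ i, g i ∘ₗ LinearMap.proj i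
  let H : (∀ i, P i) →ₗ[𝕂] V := ∑ i, h i ∘ₗ LinearMap.proj i
  have hGi : LinearMap.ker G = ⊥ := by
    rw [LinearMap.ker_eq_bot']
    intro x hx
    exact hg x (by simpa [G, LinearMap.sum_apply] using hx)
  obtain ⟨L, hL⟩ := LinearMap.exists_leftInverse_of_injective G hGi
  have single : ∀ (f : ∀ i, P i →ₗ[𝕂] V) (i : ι) (x : P i),
      (∑ j, f j ∘ₗ LinearMap.proj j : (∀ i, P i) →ₗ[𝕂] V) (Pi.single i x) = f i x := by
    intro f i x
    rw [LinearMap.sum_apply, Finset.sum_eq_single i]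
    · simp
    · intro j _ hj
      simp [Pi.single_eq_of_ne hj]
    · simp
  refine ⟨H ∘ₗ L, fun i x => ?_⟩
  have h1 : L (G (Pi.single i x)) = Pi.single i x := LinearMap.congr_fun hL _
  rw [← single g i x, LinearMap.comp_apply]
  exact (congrArg H h1).trans (single h i x)

section Graded

variable {𝕂 V : Type*} [Field 𝕂] [AddCommGroup V] [Module 𝕂 V]

theorem pow_apply_mem_of_raising {U : ℕ → Submodule 𝕂 V} {R : Module.End 𝕂 V}
    (hR : ∀ k, ∀ u ∈ U k, R u ∈ U (k + 1)) {k : ℕ} {u : V} (hu : u ∈ U k) (m : ℕ) :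
    (R ^ m) u ∈ U (k + m) := by
  induction m with
  | zero => simpa using hu
  | succ m ih =>
    rw [pow_succ', Module.End.mul_apply]
    exact hR _ _ ih

/-- Primitive vectors generate: if `R ^ (d - 2 i)` maps `U i` onto `U (d - i)` whenever `2 i ≤ d`,
then a subspace that is stable under `R` on homogeneous vectors and contains the primitive parts
`U i ⊓ ker (R ^ (d - 2 i + 1))` contains every `U k`. -/
theorem le_of_primitive_le {d : ℕ} {U : ℕ → Submodule 𝕂 V} {R : Module.End 𝕂 V}
    (hR : ∀ k, ∀ u ∈ U k, R u ∈ U (k + 1)) (hU : ∀ k, d < k → U k = ⊥)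
    (hsurj : ∀ i, 2 * i ≤ d → ∀ w ∈ U (d - i), ∃ u ∈ U i, (R ^ (d - 2 * i)) u = w)
    {N : Submodule 𝕂 V}
    (hP : ∀ i, 2 * i ≤ d → ∀ u ∈ U i, (R ^ (d - 2 * i + 1)) u = 0 → u ∈ N)
    (hN : ∀ k, ∀ u ∈ U k, u ∈ N → R u ∈ N) (k : ℕ) : U k ≤ N := by
  have hpow : ∀ (m k : ℕ) (u : V), u ∈ U k → u ∈ N → (R ^ m) u ∈ N := by
    intro m k u hu huN
    induction m with
    | zero => simpa using huN
    | succ m ih =>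
      rw [pow_succ', Module.End.mul_apply]
      exact hN _ _ (pow_apply_mem_of_raising hR hu m) ih
  have low : ∀ i, 2 * i ≤ d → U i ≤ N := by
    intro i
    induction i with
    | zero =>
      intro _ u hu
      refine hP 0 (by omega) u hu ?_
      have := pow_apply_mem_of_raising hR hu (d - 2 * 0 + 1)
      rwa [hU _ (by omega), Submodule.mem_bot] at this
    | succ i ih =>
      intro hi u hu
      have h1 := pow_apply_mem_of_raising hR hu (d - 2 * (i + 1) + 1)
      rw [show i + 1 + (d - 2 * (i + 1) + 1) = d - i by omega] at h1
      obtain ⟨w, hw, hwu⟩ := hsurj i (by omega) _ h1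
      have hwN := ih (by omega) hw
      have h2 : u - R w ∈ N := by
        refine hP (i + 1) hi _ (sub_mem hu (hR _ _ hw)) ?_
        rw [map_sub, ← hwu, ← Module.End.mul_apply, ← pow_succ,
          show d - 2 * (i + 1) + 1 + 1 = d - 2 * i by omega, sub_self]
      simpa using add_mem h2 (hN _ _ hw hwN)
  intro u hu
  rcases lt_or_ge d k with hk | hk
  · rw [hU k hk, Submodule.mem_bot] at hu
    simp [hu]
  rcases le_or_gt (2 * k) d with h | h
  · exact low k h hu
  · obtain ⟨w, hw, rfl⟩ := hsurj (d - k) (by omega) u (by rwa [show d - (d - k) = k by omega])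
    exact hpow _ _ _ hw (low _ (by omega) hw)

/-- If `R ^ (d - 2 i)` is injective on `U i` whenever `2 i ≤ d`, the vectors `R ^ j p` with `p`
primitive of degree `i` and `j ≤ d - 2 i` are independent, so there is an operator that sends each
of them to a prescribed multiple of `R ^ (j - 1) p`. -/
theorem exists_lowering {d : ℕ} {U : ℕ → Submodule 𝕂 V} {R : Module.End 𝕂 V}
    (hR : ∀ k, ∀ u ∈ U k, R u ∈ U (k + 1))
    (hind : ∀ u : ℕ → V, (∀ k, u k ∈ U k) → ∑ k ∈ Finset.range (d + 1), u k = 0 →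
      ∀ k ≤ d, u k = 0)
    (hinj : ∀ i, 2 * i ≤ d → ∀ u ∈ U i, (R ^ (d - 2 * i)) u = 0 → u = 0) (c : ℕ → ℕ → 𝕂) :
    ∃ ψ : Module.End 𝕂 V, ∀ i j, 2 * i + j ≤ d → ∀ p ∈ U i, (R ^ (d - 2 * i + 1)) p = 0 →
      ψ ((R ^ j) p) = c i j • (R ^ (j - 1)) p := by
  classical
  let ι := {x : Fin (d + 1) × Fin (d + 1) // 2 * (x.1 : ℕ) + (x.2 : ℕ) ≤ d}
  let P : ι → Submodule 𝕂 V := fun x =>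
    U (x.1.1 : ℕ) ⊓ LinearMap.ker (R ^ (d - 2 * (x.1.1 : ℕ) + 1))
  obtain ⟨ψ, hψ⟩ := LinearMap.exists_comp_eq_of_sum_injective (P := P)
    (fun x => (R ^ (x.1.2 : ℕ)) ∘ₗ (P x).subtype)
    (fun x => c x.1.1 x.1.2 • ((R ^ ((x.1.2 : ℕ) - 1)) ∘ₗ (P x).subtype)) (by
      intro x hx
      have hx' : ∑ y : ι, (R ^ (y.1.2 : ℕ)) (x y : V) = 0 := hx
      let u : ℕ → V := fun k =>
        ∑ y : ι with (y.1.1 : ℕ) + (y.1.2 : ℕ) = k, (R ^ (y.1.2 : ℕ)) (x y : V)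
      have hu : ∀ k, u k ∈ U k := by
        intro k
        refine Submodule.sum_mem _ fun y hy => ?_
        rw [← (Finset.mem_filter.1 hy).2]
        exact pow_apply_mem_of_raising hR (x y).2.1 _
      have hu0 : ∀ k ≤ d, u k = 0 := by
        refine hind u hu ?_
        rw [← hx']
        exact Finset.sum_fiberwise_of_maps_to
          (fun y _ => Finset.mem_range.2 (by have := y.2; omega)) _
      have key : ∀ (n : ℕ) (y : ι), (y.1.1 : ℕ) = n → (x y : V) = 0 := by
        intro n
        induction n using Nat.strong_induction_on with
        | _ n ih =>
          intro y hy
          have hyd := y.2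
          have h1 := congrArg (R ^ (d - 2 * (y.1.1 : ℕ) - (y.1.2 : ℕ)))
            (hu0 ((y.1.1 : ℕ) + (y.1.2 : ℕ)) (by omega))
          rw [map_zero, map_sum, Finset.sum_eq_single y] at h1
          · rw [← Module.End.mul_apply, ← pow_add, Nat.sub_add_cancel (by omega)] at h1
            exact hinj _ (by omega) _ (x y).2.1 h1
          · intro z hz hzy
            have hzk := (Finset.mem_filter.1 hz).2
            have hzd := z.2
            rcases lt_trichotomy (z.1.1 : ℕ) (y.1.1 : ℕ) with h | h | h
            · simp [ih _ (hy ▸ h) z rfl]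
            · exact absurd (Subtype.ext (Prod.ext (Fin.ext h) (Fin.ext (by omega)))) hzy
            · -- a primitive vector of larger degree is killed by a smaller power of `R`
              rw [← Module.End.mul_apply, ← pow_add,
                show d - 2 * (y.1.1 : ℕ) - (y.1.2 : ℕ) + (z.1.2 : ℕ) =
                  ((z.1.1 : ℕ) - (y.1.1 : ℕ) - 1) + (d - 2 * (z.1.1 : ℕ) + 1) by omega,
                pow_add, Module.End.mul_apply, (x z).2.2, map_zero]
          · intro h
            simp at h
      funext y
      exact Subtype.ext (key _ y rfl))
  refine ⟨ψ, fun i j hij p hp hp' => ?_⟩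
  exact hψ ⟨(⟨i, by omega⟩, ⟨j, by omega⟩), hij⟩ ⟨p, hp, hp'⟩

end Graded

/-! ### The `q`-Weyl relation for the candidate for `B` -/

/-- If `[ψ, R] = (q - q⁻¹)(K - K⁻¹)` with `R = A - a K - a⁻¹ K⁻¹`, where `K` `q`-commutes with `R`
and with `ψ`, then `S = (1 - a q ψ)(1 - a⁻¹ q ψ)⁻¹ K` satisfies the relation that `K` satisfies with
`A`, but with `a` and `a⁻¹` exchanged. -/
theorem qWeyl_of_psi {𝕂 𝒜 : Type*} [Field 𝕂] [Ring 𝒜] [Algebra 𝕂 𝒜] {q a : 𝕂} (hq : q ≠ 0)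
    (ha : a ≠ 0) {A K K' ψ s : 𝒜} (hKK' : K * K' = 1) (hK'K : K' * K = 1)
    (hA : q • (K * A) - q⁻¹ • (A * K) = (q - q⁻¹) • (a • (K * K) + a⁻¹ • 1))
    (hKψ : K * ψ = q ^ 2 • (ψ * K))
    (hψ : ψ * (A - a • K - a⁻¹ • K') - (A - a • K - a⁻¹ • K') * ψ = (q - q⁻¹) • (K - K'))
    (hs : s * (1 - (a⁻¹ * q) • ψ) = 1) (hs' : (1 - (a⁻¹ * q) • ψ) * s = 1) :
    q • ((1 - (a * q) • ψ) * s * K * A) - q⁻¹ • (A * ((1 - (a * q) • ψ) * s * K)) =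
      (q - q⁻¹) • (a⁻¹ • (((1 - (a * q) • ψ) * s * K) * ((1 - (a * q) • ψ) * s * K)) + a • 1) := by
  set X : 𝒜 := 1 - (a⁻¹ * q) • ψ with hX
  have hY : 1 - (a * q) • ψ = a ^ 2 • X + (1 - a ^ 2) • (1 : 𝒜) := by
    rw [hX]; match_scalars <;> field_simp <;> ring
  have hS : (1 - (a * q) • ψ) * s = a ^ 2 • 1 + (1 - a ^ 2) • s := by
    rw [hY, add_mul, smul_mul_assoc, hs', smul_mul_assoc, one_mul]
  have hS' : s * (1 - (a * q) • ψ) = a ^ 2 • 1 + (1 - a ^ 2) • s := by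
    rw [hY, mul_add, mul_smul_comm, hs, mul_smul_comm, mul_one]
  have hK'ψ : K' * ψ = (q ^ 2)⁻¹ • (ψ * K') := by
    have h1 : K' * (K * ψ) * K' = q ^ 2 • (K' * (ψ * K) * K') := by
      rw [hKψ]; simp only [mul_smul_comm, smul_mul_assoc]
    have h2 : K' * (K * ψ) * K' = ψ * K' := by rw [← mul_assoc, hK'K, one_mul]
    have h3 : K' * (ψ * K) * K' = K' * ψ := by rw [mul_assoc, mul_assoc, hKK', mul_one]
    rw [h2, h3] at h1
    rw [h1, smul_smul, inv_mul_cancel₀ (pow_ne_zero 2 hq), one_smul]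
  have hψA : ψ * A - A * ψ = (q - q⁻¹) • ((1 - (a * q) • ψ) * K - K' * X) := by
    rw [hX]
    simp only [mul_sub, sub_mul, mul_smul_comm, smul_mul_assoc, mul_one, one_mul, hKψ, hK'ψ] at hψ ⊢
    have h2 : ψ * A - A * ψ = (q - q⁻¹) • (K - K') + a • (ψ * K) + a⁻¹ • (ψ * K')
        - a • q ^ 2 • (ψ * K) - a⁻¹ • (q ^ 2)⁻¹ • (ψ * K') := by
      rw [← hψ]; module
    rw [h2]
    match_scalars <;> field_simp <;> ring
  have hXA : X * A - A * X = -((a⁻¹ * q) • (ψ * A - A * ψ)) := by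
    rw [hX]; simp only [mul_sub, sub_mul, mul_smul_comm, smul_mul_assoc, mul_one, one_mul]; module
  have hsA : s * A = A * s +
      (a⁻¹ * q * (q - q⁻¹)) • ((a ^ 2 • 1 + (1 - a ^ 2) • s) * K * s - s * K') := by
    have h1 : s * (X * A - A * X) * s = A * s - s * A := by
      rw [mul_sub, sub_mul, ← mul_assoc s X A, hs, one_mul, mul_assoc s (A * X) s,
        mul_assoc A X s, hs', mul_one]
    have h2 : s * ((1 - (a * q) • ψ) * K - K' * X) * s =
        (a ^ 2 • 1 + (1 - a ^ 2) • s) * K * s - s * K' := by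
      rw [mul_sub, sub_mul, ← mul_assoc s _ K, hS', mul_assoc s (K' * X) s, mul_assoc K' X s, hs',
        mul_one]
    rw [hXA, hψA, smul_smul, mul_neg, neg_mul, mul_smul_comm, smul_mul_assoc, h2] at h1
    rw [neg_eq_iff_eq_neg.1 h1]; abel
  have hKA : K * A = (q⁻¹ * q⁻¹) • (A * K) + (q⁻¹ * (q - q⁻¹)) • (a • (K * K) + a⁻¹ • 1) := by
    rw [mul_smul, mul_smul, ← hA]
    match_scalars <;> field_simp <;> ring
  rw [hS]
  have e1 : (a ^ 2 • 1 + (1 - a ^ 2) • s) * K * A =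
      (q⁻¹ * q⁻¹) • (a ^ 2 • (A * K) + (1 - a ^ 2) • (s * A * K)) +
      (q⁻¹ * (q - q⁻¹)) • (a • ((a ^ 2 • 1 + (1 - a ^ 2) • s) * (K * K))
        + a⁻¹ • (a ^ 2 • 1 + (1 - a ^ 2) • s)) := by
    rw [mul_assoc, hKA]
    simp only [mul_add, add_mul, mul_smul_comm, smul_mul_assoc, mul_one, one_mul, mul_assoc]
  rw [e1, hsA]
  simp only [mul_add, add_mul, mul_sub, sub_mul, mul_smul_comm, smul_mul_assoc, mul_one, one_mul,
    mul_assoc, hK'K]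
  match_scalars <;> field_simp <;> ring
/-! ### Eigenspace projections of a tridiagonal pair -/

section Resolution

variable {𝕂 V : Type*} [Field 𝕂] [AddCommGroup V] [Module 𝕂 V]

/-- `E 0, …, E d` are the nonzero orthogonal projections onto the eigenspaces of `A`, with distinct
eigenvalues `θ 0, …, θ d`, and `A'` is block tridiagonal with respect to them. -/
structure IsTridiagonalResolution (A A' : Module.End 𝕂 V) {d : ℕ} (θ : ℕ → 𝕂)
    (E : Fin (d + 1) → Module.End 𝕂 V) : Prop where
  sum_apply : ∀ v, ∑ i, E i v = v
  apply_self : ∀ i v, E i (E i v) = E i v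
  apply_of_ne : ∀ i j, i ≠ j → ∀ v, E i (E j v) = 0
  map_apply : ∀ i v, A (E i v) = θ i • E i v
  injective : ∀ i j : Fin (d + 1), θ i = θ j → i = j
  exists_ne_zero : ∀ i, ∃ v, E i v ≠ 0
  tridiagonal : ∀ i j : Fin (d + 1), ((i : ℕ) + 1 < j ∨ (j : ℕ) + 1 < i) →
    ∀ v, E i (A' (E j v)) = 0

theorem IsStandardIdempotentOrdering.resolution {A A' : Module.End 𝕂 V} {d : ℕ} {θ : ℕ → 𝕂}
    {E : Fin (d + 1) → Module.End 𝕂 V} (h : IsStandardIdempotentOrdering A A' E)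
    (hA : IsDiagonalizableEnd A) (hE : ∀ i : Fin (d + 1), A * E i = θ i • E i) :
    IsTridiagonalResolution A A' θ E := by
  obtain ⟨W, ⟨⟨hinj, hrange⟩, hstd⟩, hEW⟩ := h
  have htop : ⨆ i, W i = ⊤ := by
    rw [eq_top_iff, ← hA]
    refine iSup_le fun μ => ?_
    by_cases hμ : A.eigenspace μ = ⊥
    · simp [hμ]
    · have : A.eigenspace μ ∈ Set.range W := by rw [hrange]; exact ⟨hμ, μ, rfl⟩
      obtain ⟨i, hi⟩ := this
      rw [← hi]; exact le_iSup W i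
  have hmem : ∀ (S : Submodule 𝕂 V), (∀ i, ∀ w ∈ W i, w ∈ S) → ∀ v, v ∈ S := by
    intro S hS v
    have : (⊤ : Submodule 𝕂 V) ≤ S := htop ▸ iSup_le fun i w hw => hS i w hw
    exact this trivial
  have hmapE : ∀ i v, A (E i v) = θ i • E i v := fun i v => LinearMap.congr_fun (hE i) v
  have hW : ∀ i, W i ≠ ⊥ ∧ ∃ μ : 𝕂, W i = A.eigenspace μ := by
    intro i
    have : W i ∈ Set.range W := ⟨i, rfl⟩
    rw [hrange] at this
    exact this
  have hWθ : ∀ i, W i = A.eigenspace (θ i) := by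
    intro i
    obtain ⟨h0, μ, hμ⟩ := hW i
    obtain ⟨w, hw, hw0⟩ := Submodule.exists_mem_ne_zero_of_ne_bot h0
    have h1 : A w = θ i • w := by
      have := hmapE i w
      rwa [(hEW i).1 w hw] at this
    have h2 : A w = μ • w := Module.End.mem_eigenspace_iff.1 (hμ ▸ hw)
    have : (μ - θ i) • w = 0 := by rw [sub_smul, ← h1, ← h2, sub_self]
    rcases smul_eq_zero.1 this with h | h
    · rw [hμ, sub_eq_zero.1 h]
    · exact absurd h hw0
  have hEmem : ∀ i v, E i v ∈ W i := by
    intro i v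
    rw [hWθ i, Module.End.mem_eigenspace_iff]
    exact hmapE i v
  refine ⟨fun v => ?_, fun i v => (hEW i).1 _ (hEmem i v),
    fun i j hij v => (hEW i).2 j hij.symm _ (hEmem j v), hmapE, fun i j hij => hinj ?_,
    fun i => ?_, fun i j hij v => ?_⟩
  · have := hmem (LinearMap.eqLocus (∑ i, E i) LinearMap.id) (fun i w hw => by
      rw [LinearMap.mem_eqLocus, LinearMap.sum_apply, Finset.sum_eq_single i]
      · exact (hEW i).1 w hw
      · exact fun j _ hj => (hEW j).2 i hj.symm w hw
      · simp) v
    simpa [LinearMap.mem_eqLocus, LinearMap.sum_apply] using this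
  · rw [hWθ i, hWθ j, hij]
  · obtain ⟨w, hw, hw0⟩ := Submodule.exists_mem_ne_zero_of_ne_bot (hW i).1
    exact ⟨w, by rwa [(hEW i).1 w hw]⟩
  · have h1 := hstd j (Submodule.mem_map_of_mem (hEmem j v))
    have h2 : (⨆ k : Fin (d + 1), ⨆ _ : (k : ℕ) ≤ (j : ℕ) + 1 ∧ (j : ℕ) ≤ (k : ℕ) + 1, W k) ≤
        LinearMap.ker (E i) := by
      refine iSup₂_le fun k hk w hw => (hEW i).2 k ?_ w hw
      rintro rfl
      omega
    exact h2 h1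

namespace IsTridiagonalResolution

variable {A A' : Module.End 𝕂 V} {d : ℕ} {θ : ℕ → 𝕂} {E : Fin (d + 1) → Module.End 𝕂 V}

theorem apply_map (h : IsTridiagonalResolution A A' θ E) (i : Fin (d + 1)) (v : V) :
    E i (A v) = θ i • E i v := by
  conv_lhs => rw [← h.sum_apply v, map_sum, map_sum]
  rw [Finset.sum_eq_single i]
  · rw [h.map_apply, map_smul, h.apply_self]
  · intro j _ hj
    rw [h.map_apply, map_smul, h.apply_of_ne i j hj.symm, smul_zero]
  · simp

theorem eq_zero_of_forall (h : IsTridiagonalResolution A A' θ E) {v : V} (hv : ∀ i, E i v = 0) :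
    v = 0 := by
  rw [← h.sum_apply v]
  exact Finset.sum_eq_zero fun i _ => hv i

theorem apply_map'_eq_zero (h : IsTridiagonalResolution A A' θ E) (i : Fin (d + 1)) {v : V}
    (hv : ∀ j : Fin (d + 1), (j : ℕ) ≤ i + 1 → (i : ℕ) ≤ j + 1 → E j v = 0) : E i (A' v) = 0 := by
  rw [← h.sum_apply v, map_sum, map_sum]
  refine Finset.sum_eq_zero fun j _ => ?_
  by_cases hj : (j : ℕ) ≤ i + 1 ∧ (i : ℕ) ≤ j + 1
  · rw [hv j hj.1 hj.2, map_zero, map_zero]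
  · exact h.tridiagonal i j (by omega) v

theorem mem_iSup_range_iff (h : IsTridiagonalResolution A A' θ E) (p : Fin (d + 1) → Prop)
    (v : V) : v ∈ (⨆ j : Fin (d + 1), ⨆ _ : p j, LinearMap.range (E j)) ↔
      ∀ j, ¬ p j → E j v = 0 := by
  constructor
  · intro hv j hj
    have : (⨆ j : Fin (d + 1), ⨆ _ : p j, LinearMap.range (E j)) ≤ LinearMap.ker (E j) := by
      refine iSup₂_le fun k hk => ?_
      rintro _ ⟨w, rfl⟩
      refine h.apply_of_ne j k ?_ w
      rintro rfl
      exact hj hk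
    exact this hv
  · intro hv
    rw [← h.sum_apply v]
    refine Submodule.sum_mem _ fun j _ => ?_
    by_cases hj : p j
    · exact Submodule.mem_iSup_of_mem j (Submodule.mem_iSup_of_mem hj ⟨v, rfl⟩)
    · rw [hv j hj]; exact zero_mem _

end IsTridiagonalResolution

end Resolution

/-! ### The split decomposition -/

namespace TDSystem

variable {𝕂 V : Type*} [Field 𝕂] [AddCommGroup V] [Module 𝕂 V] {d : ℕ}

/-- The eigenvalues `a q^{d-2n} + a⁻¹ q^{2n-d}` of `q`-Racah type, indexed by all natural numbers. -/
def qRacahEigenvalue (d : ℕ) (q a : 𝕂) (n : ℕ) : 𝕂 :=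
  a * q ^ ((d : ℤ) - 2 * (n : ℤ)) + a⁻¹ * q ^ (2 * (n : ℤ) - (d : ℤ))

theorem IsQRacah.resolution {Φ : TDSystem 𝕂 V d} {q a b : 𝕂} (h : Φ.IsQRacah q a b) :
    IsTridiagonalResolution Φ.A Φ.Astar (qRacahEigenvalue d q a) Φ.E :=
  Φ.standard.resolution Φ.isTridiagonalPair.diagonalizable h.eigenvalue

theorem IsQRacah.resolution_star {Φ : TDSystem 𝕂 V d} {q a b : 𝕂} (h : Φ.IsQRacah q a b) :
    IsTridiagonalResolution Φ.Astar Φ.A (qRacahEigenvalue d q b) Φ.Estar :=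
  Φ.standard_star.resolution Φ.isTridiagonalPair.diagonalizable' h.eigenvalue_star

/-- `E_0^* V + ⋯ + E_{n-1}^* V`, as the common kernel of the other projections. -/
def lo (Φ : TDSystem 𝕂 V d) (n : ℕ) : Submodule 𝕂 V :=
  ⨅ j : Fin (d + 1), ⨅ _ : n ≤ (j : ℕ), LinearMap.ker (Φ.Estar j)

/-- `E_n V + ⋯ + E_d V`, as the common kernel of the other projections. -/
def hi (Φ : TDSystem 𝕂 V d) (n : ℕ) : Submodule 𝕂 V :=
  ⨅ j : Fin (d + 1), ⨅ _ : (j : ℕ) < n, LinearMap.ker (Φ.E j)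

/-- The component `U_n` of the split decomposition, for all natural numbers `n`; it vanishes for
`n > d`. -/
def split (Φ : TDSystem 𝕂 V d) (n : ℕ) : Submodule 𝕂 V := Φ.lo (n + 1) ⊓ Φ.hi n

theorem mem_lo {Φ : TDSystem 𝕂 V d} {n : ℕ} {v : V} :
    v ∈ Φ.lo n ↔ ∀ j : Fin (d + 1), n ≤ (j : ℕ) → Φ.Estar j v = 0 := by
  simp [lo, Submodule.mem_iInf]

theorem mem_hi {Φ : TDSystem 𝕂 V d} {n : ℕ} {v : V} :
    v ∈ Φ.hi n ↔ ∀ j : Fin (d + 1), (j : ℕ) < n → Φ.E j v = 0 := by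
  simp [hi, Submodule.mem_iInf]

theorem lo_mono (Φ : TDSystem 𝕂 V d) : Monotone Φ.lo := fun _ _ hmn _ hv =>
  mem_lo.2 fun j hj => mem_lo.1 hv j (hmn.trans hj)

theorem hi_anti (Φ : TDSystem 𝕂 V d) : Antitone Φ.hi := fun _ _ hmn _ hv =>
  mem_hi.2 fun j hj => mem_hi.1 hv j (hj.trans_le hmn)

section QRacah

variable {Φ : TDSystem 𝕂 V d} {q a b : 𝕂}

theorem IsQRacah.U_eq_split (h : Φ.IsQRacah q a b) (i : Fin (d + 1)) : Φ.U i = Φ.split i := by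
  ext v
  rw [U, split, Submodule.mem_inf, Submodule.mem_inf, h.resolution_star.mem_iSup_range_iff,
    h.resolution.mem_iSup_range_iff, mem_lo, mem_hi]
  simp only [not_le, Fin.lt_def, Nat.succ_le_iff]

theorem IsQRacah.lo_zero (h : Φ.IsQRacah q a b) : Φ.lo 0 = ⊥ := by
  rw [eq_bot_iff]
  intro v hv
  exact h.resolution_star.eq_zero_of_forall fun i => mem_lo.1 hv i (Nat.zero_le _)

theorem IsQRacah.hi_eq_bot (h : Φ.IsQRacah q a b) {n : ℕ} (hn : d < n) : Φ.hi n = ⊥ := by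
  rw [eq_bot_iff]
  intro v hv
  exact h.resolution.eq_zero_of_forall fun i => mem_hi.1 hv i (by omega)

theorem IsQRacah.map_A_lo (h : Φ.IsQRacah q a b) {n : ℕ} {v : V} (hv : v ∈ Φ.lo n) :
    Φ.A v ∈ Φ.lo (n + 1) :=
  mem_lo.2 fun j hj => h.resolution_star.apply_map'_eq_zero j fun k _ hk =>
    mem_lo.1 hv k (by omega)

theorem IsQRacah.map_Astar_hi (h : Φ.IsQRacah q a b) {n : ℕ} {v : V} (hv : v ∈ Φ.hi n) :
    Φ.Astar v ∈ Φ.hi (n - 1) :=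
  mem_hi.2 fun j hj => h.resolution.apply_map'_eq_zero j fun k hk _ =>
    mem_hi.1 hv k (by omega)

theorem IsQRacah.sub_smul_mem_hi (h : Φ.IsQRacah q a b) {n : ℕ} {v : V} (hv : v ∈ Φ.hi n) :
    Φ.A v - qRacahEigenvalue d q a n • v ∈ Φ.hi (n + 1) := by
  refine mem_hi.2 fun j hj => ?_
  rw [map_sub, h.resolution.apply_map, map_smul]
  rcases Nat.lt_succ_iff_lt_or_eq.1 hj with hj | hj
  · simp [mem_hi.1 hv j hj]
  · simp [hj]

theorem IsQRacah.sub_smul_mem_lo (h : Φ.IsQRacah q a b) {n : ℕ} {v : V} (hv : v ∈ Φ.lo (n + 1)) :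
    Φ.Astar v - qRacahEigenvalue d q b n • v ∈ Φ.lo n := by
  refine mem_lo.2 fun j hj => ?_
  rw [map_sub, h.resolution_star.apply_map, map_smul]
  rcases Nat.eq_or_lt_of_le hj with hj | hj
  · simp [hj]
  · simp [mem_lo.1 hv j hj]

theorem IsQRacah.sub_smul_mem_inf (h : Φ.IsQRacah q a b) {m n : ℕ} {v : V}
    (hv : v ∈ Φ.lo m ⊓ Φ.hi n) :
    Φ.A v - qRacahEigenvalue d q a n • v ∈ Φ.lo (m + 1) ⊓ Φ.hi (n + 1) :=
  ⟨sub_mem (h.map_A_lo hv.1) (Submodule.smul_mem _ _ (Φ.lo_mono (Nat.le_succ m) hv.1)),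
    h.sub_smul_mem_hi hv.2⟩

/-- The sum of the `lo (n + s) ⊓ hi n` is stable under `A` and `A^*`. The shift `s = 0` gives zero
and the shift `s = 1` gives `V`. -/
theorem IsQRacah.iSup_inf_eq_bot_or_top (h : Φ.IsQRacah q a b) (s : ℕ) :
    (⨆ n, Φ.lo (n + s) ⊓ Φ.hi n) = ⊥ ∨ (⨆ n, Φ.lo (n + s) ⊓ Φ.hi n) = ⊤ := by
  have hle : ∀ n, Φ.lo (n + s) ⊓ Φ.hi n ≤ ⨆ n, Φ.lo (n + s) ⊓ Φ.hi n :=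
    le_iSup fun n => Φ.lo (n + s) ⊓ Φ.hi n
  refine Φ.isTridiagonalPair.irreducible _ ?_ ?_
  · rw [Submodule.map_iSup]
    refine iSup_le fun n => ?_
    rintro _ ⟨v, hv, rfl⟩
    have h1 := h.sub_smul_mem_inf hv
    rw [Nat.add_right_comm] at h1
    simpa using add_mem (hle (n + 1) h1) (Submodule.smul_mem _ (qRacahEigenvalue d q a n) (hle n hv))
  · rw [Submodule.map_iSup]
    refine iSup_le fun n => ?_
    rintro _ ⟨v, hv, rfl⟩
    rcases Nat.eq_zero_or_pos (n + s) with h0 | h0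
    · have hv1 := hv.1
      rw [h0, h.lo_zero] at hv1
      rw [show v = 0 from hv1, map_zero]
      exact zero_mem _
    · have h1 : Φ.Astar v - qRacahEigenvalue d q b (n + s - 1) • v ∈ Φ.lo (n + s - 1) :=
        h.sub_smul_mem_lo (by rw [Nat.sub_add_cancel h0]; exact hv.1)
      have h2 : Φ.Astar v - qRacahEigenvalue d q b (n + s - 1) • v ∈ Φ.hi (n - 1) :=
        sub_mem (h.map_Astar_hi hv.2)
          (Submodule.smul_mem _ _ (Φ.hi_anti (Nat.sub_le n 1) hv.2))
      have h3 : Φ.Astar v - qRacahEigenvalue d q b (n + s - 1) • v ∈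
          ⨆ n, Φ.lo (n + s) ⊓ Φ.hi n := by
        refine hle (n - 1) ⟨?_, h2⟩
        exact Φ.lo_mono (by omega) h1
      simpa using add_mem h3
        (Submodule.smul_mem _ (qRacahEigenvalue d q b (n + s - 1)) (hle n hv))

theorem IsQRacah.lo_inf_hi (h : Φ.IsQRacah q a b) (n : ℕ) : Φ.lo n ⊓ Φ.hi n = ⊥ := by
  have hle := le_iSup (fun n => Φ.lo (n + 0) ⊓ Φ.hi n) n
  rcases h.iSup_inf_eq_bot_or_top 0 with h1 | h1
  · rwa [h1, le_bot_iff] at hle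
  · exfalso
    have h2 : (⨆ n, Φ.lo (n + 0) ⊓ Φ.hi n) ≤ Φ.hi 1 := by
      refine iSup_le fun n => ?_
      rcases Nat.eq_zero_or_pos n with rfl | hn
      · rw [h.lo_zero, bot_inf_eq]; exact bot_le
      · exact inf_le_right.trans (Φ.hi_anti hn)
    rw [h1] at h2
    obtain ⟨v, hv⟩ := h.resolution.exists_ne_zero 0
    exact hv (mem_hi.1 (h2 (Submodule.mem_top (x := v))) 0 (by simp))

theorem IsQRacah.iSup_split (h : Φ.IsQRacah q a b) : ⨆ n, Φ.split n = ⊤ := by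
  refine (h.iSup_inf_eq_bot_or_top 1).resolve_left fun h1 => ?_
  obtain ⟨v, hv⟩ := h.resolution_star.exists_ne_zero 0
  have h2 : Φ.Estar 0 v ∈ Φ.lo (0 + 1) ⊓ Φ.hi 0 := by
    refine ⟨mem_lo.2 fun j hj => h.resolution_star.apply_of_ne j 0 ?_ v, mem_hi.2 fun j hj => ?_⟩
    · rintro rfl
      simp at hj
    · omega
  have h3 := le_iSup (fun n => Φ.lo (n + 1) ⊓ Φ.hi n) 0 h2
  rw [h1] at h3
  exact hv h3

theorem IsQRacah.split_eq_bot (h : Φ.IsQRacah q a b) {n : ℕ} (hn : d < n) : Φ.split n = ⊥ := by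
  rw [split, h.hi_eq_bot hn, inf_bot_eq]

theorem IsQRacah.lo_sup_hi (h : Φ.IsQRacah q a b) (n : ℕ) : Φ.lo n ⊔ Φ.hi n = ⊤ := by
  rw [eq_top_iff, ← h.iSup_split]
  refine iSup_le fun k => ?_
  rcases lt_or_ge k n with hk | hk
  · exact (inf_le_left.trans (Φ.lo_mono hk)).trans le_sup_left
  · exact (inf_le_right.trans (Φ.hi_anti hk)).trans le_sup_right

theorem IsQRacah.split_independent (h : Φ.IsQRacah q a b) (u : ℕ → V)
    (hu : ∀ k, u k ∈ Φ.split k) (hsum : ∑ k ∈ Finset.range (d + 1), u k = 0) :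
    ∀ k ≤ d, u k = 0 := by
  intro k
  induction k using Nat.strong_induction_on with
  | _ k ih =>
    intro hk
    have h1 : u k ∈ Φ.hi (k + 1) := by
      rw [← Finset.add_sum_erase _ _ (Finset.mem_range.2 (Nat.lt_succ_of_le hk))] at hsum
      rw [eq_neg_of_add_eq_zero_left hsum]
      refine neg_mem (Submodule.sum_mem _ fun j hj => ?_)
      obtain ⟨hjk, hjd⟩ := Finset.mem_erase.1 hj
      rcases lt_or_gt_of_ne hjk with hlt | hgt
      · rw [ih j hlt (by omega)]; exact zero_mem _
      · exact Φ.hi_anti hgt (hu j).2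
    have h2 : u k ∈ Φ.lo (k + 1) ⊓ Φ.hi (k + 1) := ⟨(hu k).1, h1⟩
    rwa [h.lo_inf_hi, Submodule.mem_bot] at h2

theorem IsQRacah.hom_ext (h : Φ.IsQRacah q a b) {X Y : Module.End 𝕂 V}
    (hXY : ∀ k ≤ d, ∀ u ∈ Φ.split k, X u = Y u) : X = Y := by
  have h1 : (⊤ : Submodule 𝕂 V) ≤ LinearMap.eqLocus X Y := by
    rw [← h.iSup_split]
    refine iSup_le fun k u hu => ?_
    rcases lt_or_ge d k with hk | hk
    · rw [h.split_eq_bot hk, Submodule.mem_bot] at hu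
      simp [hu]
    · exact hXY k hk u hu
  exact LinearMap.ext fun v => h1 trivial

theorem IsQRacah.exists_diagonal (h : Φ.IsQRacah q a b) (c : ℕ → 𝕂) :
    ∃ X : Module.End 𝕂 V, ∀ k ≤ d, ∀ u ∈ Φ.split k, X u = c k • u := by
  obtain ⟨X, hX⟩ := LinearMap.exists_comp_eq_of_sum_injective
    (P := fun i : Fin (d + 1) => Φ.split i) (fun i => (Φ.split i).subtype)
    (fun i => c i • (Φ.split i).subtype) (by
      intro x hx
      have h1 := h.split_independent
        (fun k => if hk : k < d + 1 then (x ⟨k, hk⟩ : V) else 0)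
        (fun k => by
          by_cases hk : k < d + 1
          · simp [hk]
          · simp [hk])
        (by
          rw [Finset.sum_range, ← hx]
          exact Finset.sum_congr rfl fun i _ => dif_pos i.2)
      funext i
      have h2 := h1 i (Nat.lt_succ_iff.1 i.2)
      exact Subtype.ext ((dif_pos i.2).symm.trans h2))
  exact ⟨X, fun k hk u hu => hX ⟨k, Nat.lt_succ_of_le hk⟩ ⟨u, hu⟩⟩

theorem IsQRacah.isK_iff (h : Φ.IsQRacah q a b) {X : Module.End 𝕂 V} :
    Φ.IsK q X ↔ ∀ k ≤ d, ∀ u ∈ Φ.split k, X u = q ^ ((d : ℤ) - 2 * (k : ℤ)) • u := by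
  constructor
  · intro hX k hk u hu
    exact hX ⟨k, Nat.lt_succ_of_le hk⟩ u (by rwa [h.U_eq_split])
  · intro hX i u hu
    rw [h.U_eq_split] at hu
    exact hX i (Nat.lt_succ_iff.1 i.2) u hu

theorem IsQRacah.exists_isK (h : Φ.IsQRacah q a b) :
    ∃ K : (Module.End 𝕂 V)ˣ, ∀ X : Module.End 𝕂 V, Φ.IsK q X ↔ X = K := by
  obtain ⟨X, hX⟩ := h.exists_diagonal fun k => q ^ ((d : ℤ) - 2 * (k : ℤ))
  obtain ⟨Y, hY⟩ := h.exists_diagonal fun k => (q ^ ((d : ℤ) - 2 * (k : ℤ)))⁻¹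
  have hne : ∀ k : ℕ, q ^ ((d : ℤ) - 2 * (k : ℤ)) ≠ 0 := fun k => zpow_ne_zero _ h.q_ne_zero
  refine ⟨⟨X, Y, ?_, ?_⟩, fun Z => ⟨fun hZ => ?_, fun hZ => ?_⟩⟩
  · refine h.hom_ext fun k hk u hu => ?_
    rw [Module.End.mul_apply, hY k hk u hu, map_smul, hX k hk u hu, smul_smul,
      inv_mul_cancel₀ (hne k), one_smul, Module.End.one_apply]
  · refine h.hom_ext fun k hk u hu => ?_
    rw [Module.End.mul_apply, hX k hk u hu, map_smul, hY k hk u hu, smul_smul,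
      mul_inv_cancel₀ (hne k), one_smul, Module.End.one_apply]
  · exact h.hom_ext fun k hk u hu => by rw [h.isK_iff.1 hZ k hk u hu, ← hX k hk u hu]
  · subst hZ
    exact h.isK_iff.2 hX

end QRacah

/-! ### Reversing the ordering of the eigenspaces of `A` -/

/-- The system `Φ^⇓`, in which the ordering of the `E_i` is reversed. -/
def dd (Φ : TDSystem 𝕂 V d) : TDSystem 𝕂 V d where
  A := Φ.A
  E := fun i => Φ.E i.rev
  Astar := Φ.Astar
  Estar := Φ.Estar
  isTridiagonalPair := Φ.isTridiagonalPair
  standard := by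
    obtain ⟨W, ⟨⟨hinj, hrange⟩, hstd⟩, hEW⟩ := Φ.standard
    refine ⟨fun i => W i.rev, ⟨⟨hinj.comp Fin.rev_injective, ?_⟩, fun i => ?_⟩,
      fun i => ⟨(hEW _).1, fun j hj => (hEW _).2 _ (Fin.rev_injective.ne hj)⟩⟩
    · rw [← hrange]
      exact Fin.rev_surjective.range_comp W
    · refine (hstd i.rev).trans (iSup₂_le fun j hj => ?_)
      refine le_iSup₂_of_le j.rev ?_ (by simp only [Fin.rev_rev]; exact le_rfl)
      simp only [Fin.val_rev] at hj ⊢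
      omega
  standard_star := Φ.standard_star

section QRacah

variable {Φ : TDSystem 𝕂 V d} {q a b : 𝕂}

theorem qRacahEigenvalue_inv (d : ℕ) (q a : 𝕂) {n : ℕ} (hn : n ≤ d) :
    qRacahEigenvalue d q a⁻¹ n = qRacahEigenvalue d q a (d - n) := by
  rw [qRacahEigenvalue, qRacahEigenvalue, inv_inv, add_comm, Nat.cast_sub hn]
  congr 3 <;> ring

theorem IsQRacah.dd (h : Φ.IsQRacah q a b) : Φ.dd.IsQRacah q a⁻¹ b where
  q_ne_zero := h.q_ne_zero
  a_ne_zero := inv_ne_zero h.a_ne_zero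
  b_ne_zero := h.b_ne_zero
  q_pow_four_ne_one := h.q_pow_four_ne_one
  eigenvalue i := by
    have h1 := qRacahEigenvalue_inv d q a (Nat.lt_succ_iff.1 i.2)
    have h2 := h.eigenvalue i.rev
    have h3 : (i.rev : ℕ) = d - i := by rw [Fin.val_rev]; omega
    rw [h3] at h2
    exact h2.trans (congrArg (· • Φ.E i.rev) h1.symm)
  eigenvalue_star := h.eigenvalue_star

theorem IsQRacah.Udd_eq_split (h : Φ.IsQRacah q a b) (i : Fin (d + 1)) :
    Φ.Udd i = Φ.dd.split i := by
  ext v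
  rw [Udd, split, Submodule.mem_inf, Submodule.mem_inf, h.resolution_star.mem_iSup_range_iff,
    h.resolution.mem_iSup_range_iff, mem_lo, mem_hi]
  refine and_congr ?_ ⟨fun hv j hj => hv j.rev ?_, fun hv j hj => ?_⟩
  · simp only [not_le, Fin.lt_def, Nat.succ_le_iff, TDSystem.dd]
  · rw [Fin.val_rev]; omega
  · have := hv j.rev (by rw [Fin.val_rev]; omega)
    simpa [TDSystem.dd] using this

theorem IsQRacah.isB_iff_isK_dd (h : Φ.IsQRacah q a b) {X : Module.End 𝕂 V} :
    Φ.IsB q X ↔ Φ.dd.IsK q X := by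
  refine forall_congr' fun i => ?_
  rw [h.Udd_eq_split, h.dd.U_eq_split]

theorem mem_hi_dd {n : ℕ} {v : V} :
    v ∈ Φ.dd.hi n ↔ ∀ j : Fin (d + 1), d < j + n → Φ.E j v = 0 := by
  rw [mem_hi]
  refine ⟨fun hv j hj => ?_, fun hv j hj => hv j.rev ?_⟩
  · have := hv j.rev (by rw [Fin.val_rev]; omega)
    simpa [dd] using this
  · rw [Fin.val_rev]; omega

theorem IsQRacah.mem_Ksub (h : Φ.IsQRacah q a b) (i : Fin (d + 1)) {v : V} :
    v ∈ Φ.Ksub i ↔ v ∈ Φ.split i ∧ v ∈ Φ.dd.hi i := by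
  rw [Ksub, split, Submodule.mem_inf, Submodule.mem_inf, h.resolution_star.mem_iSup_range_iff,
    h.resolution.mem_iSup_range_iff, mem_lo, mem_hi, mem_hi_dd, and_assoc]
  refine and_congr ?_ ⟨fun hv => ⟨fun j hj => hv j ?_, fun j hj => hv j ?_⟩, fun hv j hj => ?_⟩
  · simp only [not_le, Fin.lt_def, Nat.succ_le_iff]
  · rw [Fin.le_def]; omega
  · omega
  · rw [Fin.le_def] at hj
    rcases lt_or_ge (j : ℕ) i with hlt | hge
    · exact hv.1 j hlt
    · exact hv.2 j (by omega)

end QRacah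

end TDSystem
/-! ### The raising map -/

namespace TDSystem

variable {𝕂 V : Type*} [Field 𝕂] [AddCommGroup V] [Module 𝕂 V] {d : ℕ} {Φ : TDSystem 𝕂 V d}
  {q a b : 𝕂}

theorem qRacahEigenvalue_eq (d : ℕ) (q a : 𝕂) (n : ℕ) : qRacahEigenvalue d q a n =
    a * q ^ ((d : ℤ) - 2 * (n : ℤ)) + a⁻¹ * (q ^ ((d : ℤ) - 2 * (n : ℤ)))⁻¹ := by
  rw [qRacahEigenvalue, ← zpow_neg, neg_sub]

section Raising

variable {K : (Module.End 𝕂 V)ˣ}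

theorem IsQRacah.K_apply (h : Φ.IsQRacah q a b) (hK : Φ.IsK q K) {k : ℕ} {u : V}
    (hu : u ∈ Φ.split k) : (K : Module.End 𝕂 V) u = q ^ ((d : ℤ) - 2 * (k : ℤ)) • u := by
  rcases lt_or_ge d k with hk | hk
  · rw [h.split_eq_bot hk, Submodule.mem_bot] at hu
    simp [hu]
  · exact h.isK_iff.1 hK k hk u hu

theorem IsQRacah.K_inv_apply (h : Φ.IsQRacah q a b) (hK : Φ.IsK q K) {k : ℕ} {u : V}
    (hu : u ∈ Φ.split k) :
    ((K⁻¹ : (Module.End 𝕂 V)ˣ) : Module.End 𝕂 V) u = (q ^ ((d : ℤ) - 2 * (k : ℤ)))⁻¹ • u := by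
  have hne : q ^ ((d : ℤ) - 2 * (k : ℤ)) ≠ 0 := zpow_ne_zero _ h.q_ne_zero
  have h1 : ((K⁻¹ : (Module.End 𝕂 V)ˣ) : Module.End 𝕂 V) ((K : Module.End 𝕂 V) u) = u := by
    rw [← Module.End.mul_apply, Units.inv_mul, Module.End.one_apply]
  rw [h.K_apply hK hu, map_smul] at h1
  rw [eq_inv_smul_iff₀ hne, h1]

theorem IsQRacah.R_apply (h : Φ.IsQRacah q a b) (hK : Φ.IsK q K) {k : ℕ} {u : V}
    (hu : u ∈ Φ.split k) : Φ.R a K u = Φ.A u - qRacahEigenvalue d q a k • u := by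
  rw [R, LinearMap.sub_apply, LinearMap.sub_apply, LinearMap.smul_apply, LinearMap.smul_apply,
    h.K_apply hK hu, h.K_inv_apply hK hu, qRacahEigenvalue_eq]
  module

theorem IsQRacah.R_mem (h : Φ.IsQRacah q a b) (hK : Φ.IsK q K) (k : ℕ) :
    ∀ u ∈ Φ.split k, Φ.R a K u ∈ Φ.split (k + 1) := by
  intro u hu
  rw [h.R_apply hK hu]
  exact h.sub_smul_mem_inf hu

theorem IsQRacah.E_R_pow_apply (h : Φ.IsQRacah q a b) (hK : Φ.IsK q K) {i : ℕ} {u : V}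
    (hu : u ∈ Φ.split i) (j : Fin (d + 1)) (m : ℕ) :
    Φ.E j ((Φ.R a K ^ m) u) =
      (∏ k ∈ Finset.range m, (qRacahEigenvalue d q a j - qRacahEigenvalue d q a (i + k))) •
        Φ.E j u := by
  induction m with
  | zero => simp
  | succ m ih =>
    rw [pow_succ', Module.End.mul_apply,
      h.R_apply hK (pow_apply_mem_of_raising (h.R_mem hK) hu m), map_sub, map_smul,
      h.resolution.apply_map, ih, Finset.prod_range_succ]
    module

/-- On `U_i` the map `R ^ m` acts as `(A - θ_i) ⋯ (A - θ_{i+m-1})`, so its kernel is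
`U_i ∩ (E_0 V + ⋯ + E_{i+m-1} V)`. -/
theorem IsQRacah.R_pow_eq_zero_iff (h : Φ.IsQRacah q a b) (hK : Φ.IsK q K) {i m : ℕ} {u : V}
    (hu : u ∈ Φ.split i) (him : i + m ≤ d + 1) :
    (Φ.R a K ^ m) u = 0 ↔ u ∈ Φ.dd.hi (d + 1 - i - m) := by
  rw [mem_hi_dd]
  constructor
  · intro h0 j hj
    have h1 := h.E_R_pow_apply hK hu j m
    rw [h0, map_zero] at h1
    refine (smul_eq_zero.1 h1.symm).resolve_left (Finset.prod_ne_zero_iff.2 fun k hk => ?_)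
    have hk' := Finset.mem_range.1 hk
    refine sub_ne_zero.2 fun he => ?_
    have := h.resolution.injective j ⟨i + k, by omega⟩ he
    have := congrArg Fin.val this
    simp only at this
    omega
  · intro hv
    refine h.resolution.eq_zero_of_forall fun j => ?_
    rw [h.E_R_pow_apply hK hu j m]
    rcases le_or_gt (i + m) j with hj | hj
    · rw [hv j (by omega), smul_zero]
    rcases lt_or_ge (j : ℕ) i with hji | hji
    · rw [mem_hi.1 hu.2 j hji, smul_zero]
    · rw [Finset.prod_eq_zero (Finset.mem_range.2 (show (j : ℕ) - i < m by omega)), zero_smul]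
      rw [Nat.add_sub_cancel' hji, sub_self]

theorem IsQRacah.mem_Ksub_iff (h : Φ.IsQRacah q a b) (hK : Φ.IsK q K) {i : Fin (d + 1)}
    (hi : 2 * (i : ℕ) ≤ d) {v : V} :
    v ∈ Φ.Ksub i ↔ v ∈ Φ.split i ∧ (Φ.R a K ^ (d - 2 * (i : ℕ) + 1)) v = 0 := by
  rw [h.mem_Ksub]
  refine and_congr_right fun hv => ?_
  rw [h.R_pow_eq_zero_iff hK hv (by omega),
    show d + 1 - (i : ℕ) - (d - 2 * (i : ℕ) + 1) = i by omega]

theorem IsQRacah.R_pow_injective (h : Φ.IsQRacah q a b) (hK : Φ.IsK q K) (i : ℕ) (hi : 2 * i ≤ d) :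
    ∀ u ∈ Φ.split i, (Φ.R a K ^ (d - 2 * i)) u = 0 → u = 0 := by
  intro u hu h0
  rw [h.R_pow_eq_zero_iff hK hu (by omega), show d + 1 - i - (d - 2 * i) = i + 1 by omega] at h0
  have h1 : u ∈ Φ.dd.lo (i + 1) ⊓ Φ.dd.hi (i + 1) := ⟨hu.1, h0⟩
  rwa [h.dd.lo_inf_hi, Submodule.mem_bot] at h1

end Raising

/-! ### Dimensions of the split components -/

section Finrank

variable [FiniteDimensional 𝕂 V]

open Module (finrank)

theorem IsQRacah.finrank_split_add (h : Φ.IsQRacah q a b) (i : ℕ) :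
    finrank 𝕂 (Φ.split i) + finrank 𝕂 (Φ.hi (i + 1)) = finrank 𝕂 (Φ.hi i) := by
  have h1 : Φ.split i ⊔ Φ.hi (i + 1) = Φ.hi i := by
    rw [split, inf_comm, inf_sup_assoc_of_le _ (Φ.hi_anti (Nat.le_succ i)), h.lo_sup_hi, inf_top_eq]
  have h2 : Φ.split i ⊓ Φ.hi (i + 1) = ⊥ := by
    rw [eq_bot_iff, ← h.lo_inf_hi (i + 1)]
    exact inf_le_inf_right _ inf_le_left
  have h3 := Submodule.finrank_sup_add_finrank_inf_eq (Φ.split i) (Φ.hi (i + 1))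
  rw [h1, h2, finrank_bot, add_zero] at h3
  exact h3.symm

theorem IsQRacah.finrank_lo_add (h : Φ.IsQRacah q a b) (i : ℕ) :
    finrank 𝕂 (Φ.lo i) + finrank 𝕂 (Φ.hi i) = finrank 𝕂 V := by
  have h3 := Submodule.finrank_sup_add_finrank_inf_eq (Φ.lo i) (Φ.hi i)
  rw [h.lo_sup_hi, h.lo_inf_hi, finrank_bot, add_zero, finrank_top] at h3
  exact h3.symm

theorem IsQRacah.finrank_dd_hi_add (h : Φ.IsQRacah q a b) {i : ℕ} (hi : i ≤ d + 1) :
    finrank 𝕂 (Φ.dd.hi i) + finrank 𝕂 (Φ.hi (d + 1 - i)) = finrank 𝕂 V := by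
  have h1 : Φ.dd.hi i ⊓ Φ.hi (d + 1 - i) = ⊥ := by
    rw [eq_bot_iff]
    intro v hv
    refine h.resolution.eq_zero_of_forall fun j => ?_
    rcases lt_or_ge d (j + i) with hj | hj
    · exact mem_hi_dd.1 hv.1 j hj
    · exact mem_hi.1 hv.2 j (by omega)
  have h2 : Φ.dd.hi i ⊔ Φ.hi (d + 1 - i) = ⊤ := by
    rw [eq_top_iff]
    intro v _
    rw [← h.resolution.sum_apply v]
    refine Submodule.sum_mem _ fun j _ => ?_
    rcases lt_or_ge d (j + i) with hj | hj
    · refine Submodule.mem_sup_right (mem_hi.2 fun k hk => h.resolution.apply_of_ne k j ?_ v)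
      rintro rfl
      omega
    · refine Submodule.mem_sup_left (mem_hi_dd.2 fun k hk => h.resolution.apply_of_ne k j ?_ v)
      rintro rfl
      omega
  have h3 := Submodule.finrank_sup_add_finrank_inf_eq (Φ.dd.hi i) (Φ.hi (d + 1 - i))
  rw [h1, h2, finrank_bot, add_zero, finrank_top] at h3
  exact h3.symm

/-- The shape `dim U_0, …, dim U_d` is symmetric: `lo i` is a complement both of `hi i` and of the
corresponding subspace for the reversed ordering, which in turn is a complement of
`hi (d + 1 - i)`. -/
theorem IsQRacah.finrank_split_symm (h : Φ.IsQRacah q a b) {i : ℕ} (hi : i ≤ d) :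
    finrank 𝕂 (Φ.split i) = finrank 𝕂 (Φ.split (d - i)) := by
  have key : ∀ j ≤ d + 1,
      finrank 𝕂 (Φ.hi j) + finrank 𝕂 (Φ.hi (d + 1 - j)) = finrank 𝕂 V := by
    intro j hj
    have h1 := h.finrank_lo_add j
    have h2 := h.dd.finrank_lo_add j
    have h3 := h.finrank_dd_hi_add hj
    have h4 : Φ.dd.lo j = Φ.lo j := rfl
    rw [h4] at h2
    omega
  have h1 := h.finrank_split_add i
  have h2 := h.finrank_split_add (d - i)
  have h3 := key i (by omega)
  have h4 := key (i + 1) (by omega)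
  rw [show d + 1 - (i + 1) = d - i by omega] at h4
  rw [show d + 1 - i = d - i + 1 by omega] at h3
  omega

theorem IsQRacah.R_pow_surjective (h : Φ.IsQRacah q a b) {K : (Module.End 𝕂 V)ˣ} (hK : Φ.IsK q K)
    (i : ℕ) (hi : 2 * i ≤ d) :
    ∀ w ∈ Φ.split (d - i), ∃ u ∈ Φ.split i, (Φ.R a K ^ (d - 2 * i)) u = w := by
  have hmaps : ∀ u ∈ Φ.split i, (Φ.R a K ^ (d - 2 * i)) u ∈ Φ.split (d - i) := by
    intro u hu
    have := pow_apply_mem_of_raising (h.R_mem hK) hu (d - 2 * i)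
    rwa [show i + (d - 2 * i) = d - i by omega] at this
  let f : Φ.split i →ₗ[𝕂] Φ.split (d - i) := (Φ.R a K ^ (d - 2 * i)).restrict hmaps
  have hf : Function.Injective f := by
    rw [← LinearMap.ker_eq_bot, LinearMap.ker_eq_bot']
    intro u hu
    exact Subtype.ext (h.R_pow_injective hK i hi u u.2 (congrArg Subtype.val hu))
  intro w hw
  obtain ⟨u, hu⟩ := (LinearMap.injective_iff_surjective_of_finrank_eq_finrank
    (h.finrank_split_symm (by omega))).1 hf ⟨w, hw⟩
  exact ⟨u, u.2, congrArg Subtype.val hu⟩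

end Finrank

/-! ### The double lowering operator -/

section Psi

variable [FiniteDimensional 𝕂 V] {K : (Module.End 𝕂 V)ˣ}

/-- A subspace that contains every `K_i` with `2 i ≤ d` and is stable under `A - θ_k` on each `U_k`
is all of `V`. -/
theorem IsQRacah.eq_top_of_Ksub_le (h : Φ.IsQRacah q a b) {N : Submodule 𝕂 V}
    (hP : ∀ i : Fin (d + 1), 2 * (i : ℕ) ≤ d → Φ.Ksub i ≤ N)
    (hN : ∀ k, ∀ u ∈ Φ.split k, u ∈ N → Φ.A u - qRacahEigenvalue d q a k • u ∈ N) : N = ⊤ := by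
  obtain ⟨K, hK⟩ := h.exists_isK
  have hK := (hK K).2 rfl
  rw [eq_top_iff, ← h.iSup_split]
  refine iSup_le (le_of_primitive_le (h.R_mem hK) (fun k hk => h.split_eq_bot hk)
    (h.R_pow_surjective hK) (fun i hi u hu hu0 => ?_) (fun k u hu huN => ?_))
  · exact hP ⟨i, by omega⟩ hi ((h.mem_Ksub_iff hK hi).2 ⟨hu, hu0⟩)
  · rw [h.R_apply hK hu]
    exact hN k u hu huN

/-- `V` is spanned by the vectors `R ^ j p` with `p ∈ K_i` and `2 i + j ≤ d`. -/
theorem IsQRacah.hom_ext_R (h : Φ.IsQRacah q a b) (hK : Φ.IsK q K) {X Y : Module.End 𝕂 V}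
    (hXY : ∀ i j, 2 * i + j ≤ d → ∀ p ∈ Φ.split i, (Φ.R a K ^ (d - 2 * i + 1)) p = 0 →
      X ((Φ.R a K ^ j) p) = Y ((Φ.R a K ^ j) p)) : X = Y := by
  let S : Set V := {v | ∃ i j p, 2 * i ≤ d ∧ p ∈ Φ.split i ∧
    (Φ.R a K ^ (d - 2 * i + 1)) p = 0 ∧ (Φ.R a K ^ j) p = v}
  have hS : Submodule.span 𝕂 S = ⊤ := by
    refine h.eq_top_of_Ksub_le (fun i hi p hp => ?_) (fun k u hu huN => ?_)
    · obtain ⟨h1, h2⟩ := (h.mem_Ksub_iff hK hi).1 hp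
      exact Submodule.subset_span ⟨i, 0, p, hi, h1, h2, by simp⟩
    · rw [← h.R_apply hK hu]
      have hle : (Submodule.span 𝕂 S).map (Φ.R a K) ≤ Submodule.span 𝕂 S := by
        rw [Submodule.map_span_le]
        rintro _ ⟨i, j, p, hi, hp, hp0, rfl⟩
        exact Submodule.subset_span ⟨i, j + 1, p, hi, hp, hp0, by
          rw [pow_succ', Module.End.mul_apply]⟩
      exact hle (Submodule.mem_map_of_mem huN)
  refine LinearMap.ext_on hS ?_
  rintro _ ⟨i, j, p, hi, hp, hp0, rfl⟩
  rcases le_or_gt (2 * i + j) d with hj | hj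
  · exact hXY i j hj p hp hp0
  · have : (Φ.R a K ^ j) p = 0 := by
      rw [show j = (j - (d - 2 * i + 1)) + (d - 2 * i + 1) by omega, pow_add, Module.End.mul_apply,
        hp0, map_zero]
    rw [this, map_zero, map_zero]

/-- `ψ (R ^ j p) = psiCoeff q (d - 2 i) j • R ^ (j - 1) p` for `p ∈ K_i`. The coefficient vanishes
at `j = 0` and at `j = d - 2 i + 1`, where `R ^ j p = 0`. -/
def psiCoeff (q : 𝕂) (n : ℤ) (j : ℕ) : 𝕂 :=
  (q ^ (j : ℤ) - (q ^ (j : ℤ))⁻¹) * (q ^ (n - j + 1) - (q ^ (n - j + 1))⁻¹)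

theorem psiCoeff_zero (q : 𝕂) (n : ℤ) : psiCoeff q n 0 = 0 := by simp [psiCoeff]

theorem psiCoeff_succ_sub (hq : q ≠ 0) (n : ℤ) (j : ℕ) :
    psiCoeff q n (j + 1) - psiCoeff q n j =
      (q - q⁻¹) * (q ^ (n - 2 * (j : ℤ)) - (q ^ (n - 2 * (j : ℤ)))⁻¹) := by
  have e1 : q ^ (n - (j : ℤ) + 1) = q ^ (n - 2 * (j : ℤ)) * q ^ (j : ℤ) * q := by
    rw [← zpow_add₀ hq, ← zpow_add_one₀ hq]; congr 1; ring
  have e2 : q ^ (n - ((j + 1 : ℕ) : ℤ) + 1) = q ^ (n - 2 * (j : ℤ)) * q ^ (j : ℤ) := by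
    rw [← zpow_add₀ hq]; congr 1; push_cast; ring
  have e3 : q ^ ((j + 1 : ℕ) : ℤ) = q ^ (j : ℤ) * q := by
    rw [Nat.cast_succ, zpow_add_one₀ hq]
  rw [psiCoeff, psiCoeff, e1, e2, e3]
  have h1 : q ^ (n - 2 * (j : ℤ)) ≠ 0 := zpow_ne_zero _ hq
  have h2 : q ^ (j : ℤ) ≠ 0 := zpow_ne_zero _ hq
  field_simp
  ring

theorem IsQRacah.exists_psi (h : Φ.IsQRacah q a b) (hK : Φ.IsK q K) :
    ∃ ψ : Module.End 𝕂 V, (∀ X, Φ.IsPsi q a K X ↔ X = ψ) ∧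
      (K : Module.End 𝕂 V) * ψ = q ^ 2 • (ψ * (K : Module.End 𝕂 V)) ∧ ψ ^ (d + 1) = 0 := by
  have hq := h.q_ne_zero
  obtain ⟨ψ, hψ⟩ := exists_lowering (h.R_mem hK) h.split_independent (h.R_pow_injective hK)
    fun i j => psiCoeff q ((d : ℤ) - 2 * (i : ℤ)) j
  have hmem : ∀ i p, p ∈ Φ.split i → ∀ j, (Φ.R a K ^ j) p ∈ Φ.split (i + j) := fun i p hp j =>
    pow_apply_mem_of_raising (h.R_mem hK) hp j
  have hcomm : ψ * Φ.R a K - Φ.R a K * ψ =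
      (q - q⁻¹) • ((K : Module.End 𝕂 V) - ((K⁻¹ : (Module.End 𝕂 V)ˣ) : Module.End 𝕂 V)) := by
    refine h.hom_ext_R hK fun i j hij p hp hp0 => ?_
    have h1 : ψ (Φ.R a K ((Φ.R a K ^ j) p)) =
        psiCoeff q ((d : ℤ) - 2 * (i : ℤ)) (j + 1) • (Φ.R a K ^ j) p := by
      rw [← Module.End.mul_apply (Φ.R a K), ← pow_succ']
      rcases Nat.lt_or_eq_of_le hij with hlt | heq
      · simpa using hψ i (j + 1) (by omega) p hp hp0
      · have hj : j = d - 2 * i := by omega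
        rw [hj, hp0, map_zero]
        have : ((d : ℤ) - 2 * (i : ℤ)) - ((d - 2 * i + 1 : ℕ) : ℤ) + 1 = 0 := by omega
        rw [psiCoeff, this]
        simp
    have h2 : Φ.R a K (ψ ((Φ.R a K ^ j) p)) =
        psiCoeff q ((d : ℤ) - 2 * (i : ℤ)) j • (Φ.R a K ^ j) p := by
      rw [hψ i j hij p hp hp0, map_smul]
      cases j with
      | zero => rw [psiCoeff_zero, zero_smul, zero_smul]
      | succ j => rw [pow_succ', Module.End.mul_apply, Nat.add_sub_cancel]
    rw [LinearMap.sub_apply, Module.End.mul_apply, Module.End.mul_apply, h1, h2, ← sub_smul,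
      psiCoeff_succ_sub hq, LinearMap.smul_apply, LinearMap.sub_apply,
      h.K_apply hK (hmem i p hp j), h.K_inv_apply hK (hmem i p hp j), ← sub_smul, smul_smul,
      show (d : ℤ) - 2 * (i : ℤ) - 2 * (j : ℤ) = (d : ℤ) - 2 * ((i + j : ℕ) : ℤ) by
        push_cast; ring]
  have hkill : ∀ i : Fin (d + 1), 2 * (i : ℕ) ≤ d → ∀ v ∈ Φ.Ksub i, ψ v = 0 := by
    intro i hi v hv
    obtain ⟨h1, h2⟩ := (h.mem_Ksub_iff hK hi).1 hv
    have h3 := hψ i 0 (by omega) v h1 h2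
    rwa [psiCoeff_zero, zero_smul, pow_zero, Module.End.one_apply] at h3
  refine ⟨ψ, fun X => ⟨fun hX => ?_, ?_⟩, ?_, ?_⟩
  · refine h.hom_ext_R hK fun i j hij p hp hp0 => ?_
    have h1 : Commute (X - ψ) (Φ.R a K) := by
      have h2 := hX.1.trans hcomm.symm
      rw [Commute, SemiconjBy, sub_mul, mul_sub, sub_eq_sub_iff_sub_eq_sub]
      exact h2
    have h2 := LinearMap.congr_fun (h1.pow_right j).eq p
    have h3 : p ∈ Φ.Ksub ⟨i, by omega⟩ :=
      (h.mem_Ksub_iff hK (i := ⟨i, by omega⟩) (by simp only; omega)).2 ⟨hp, hp0⟩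
    rw [Module.End.mul_apply, Module.End.mul_apply, LinearMap.sub_apply, LinearMap.sub_apply,
      hX.2 ⟨i, by omega⟩ (by simp only; omega) p h3,
      hkill ⟨i, by omega⟩ (by simp only; omega) p h3, sub_zero, map_zero] at h2
    exact sub_eq_zero.1 h2
  · rintro rfl
    exact ⟨hcomm, hkill⟩
  · refine h.hom_ext_R hK fun i j hij p hp hp0 => ?_
    rw [Module.End.mul_apply, LinearMap.smul_apply, Module.End.mul_apply,
      h.K_apply hK (hmem i p hp j), map_smul, hψ i j hij p hp hp0, map_smul]
    cases j with
    | zero => simp [psiCoeff_zero]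
    | succ j =>
      rw [Nat.add_sub_cancel, h.K_apply hK (hmem i p hp j), smul_smul, smul_smul, smul_smul]
      congr 1
      rw [show (d : ℤ) - 2 * ((i + j : ℕ) : ℤ) = 2 + ((d : ℤ) - 2 * ((i + (j + 1) : ℕ) : ℤ)) by
        push_cast; ring, zpow_add₀ hq, zpow_ofNat]
      ring
  · refine h.hom_ext_R hK fun i j hij p hp hp0 => ?_
    have key : ∀ j, 2 * i + j ≤ d → (ψ ^ (j + 1)) ((Φ.R a K ^ j) p) = 0 := by
      intro j
      induction j with
      | zero =>
        intro hj
        rw [pow_succ, Module.End.mul_apply, hψ i 0 hj p hp hp0, psiCoeff_zero, zero_smul, map_zero]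
      | succ j ih =>
        intro hj
        rw [pow_succ, Module.End.mul_apply, hψ i (j + 1) hj p hp hp0, map_smul,
          Nat.add_sub_cancel, ih (by omega), smul_zero]
    rw [show d + 1 = (d - j) + (j + 1) by omega, pow_add, Module.End.mul_apply, key j hij, map_zero,
      LinearMap.zero_apply]

end Psi

/-! ### Comparison of `B` with `K` -/

section Comparison

theorem zpow_sub_two_mul_succ (hq : q ≠ 0) (d k : ℕ) :
    q ^ ((d : ℤ) - 2 * ((k + 1 : ℕ) : ℤ)) = q⁻¹ * q⁻¹ * q ^ ((d : ℤ) - 2 * (k : ℤ)) := by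
  rw [show (d : ℤ) - 2 * ((k + 1 : ℕ) : ℤ) = -1 + (-1 + ((d : ℤ) - 2 * (k : ℤ))) by
    push_cast; ring, zpow_add₀ hq, zpow_add₀ hq, zpow_neg_one, mul_assoc]

theorem IsQRacah.qWeyl_K (h : Φ.IsQRacah q a b) {K : (Module.End 𝕂 V)ˣ} (hK : Φ.IsK q K) :
    q • ((K : Module.End 𝕂 V) * Φ.A) - q⁻¹ • (Φ.A * (K : Module.End 𝕂 V)) =
      (q - q⁻¹) • (a • ((K : Module.End 𝕂 V) * (K : Module.End 𝕂 V)) + a⁻¹ • 1) := by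
  have hq := h.q_ne_zero
  refine h.hom_ext fun k hk u hu => ?_
  have h1 : Φ.A u = Φ.R a K u + qRacahEigenvalue d q a k • u := by
    rw [h.R_apply hK hu, sub_add_cancel]
  have h2 := h.K_apply hK (h.R_mem hK k u hu)
  have h4 : q ^ ((d : ℤ) - 2 * (k : ℤ)) ≠ 0 := zpow_ne_zero _ hq
  rw [zpow_sub_two_mul_succ hq] at h2
  simp only [LinearMap.sub_apply, LinearMap.add_apply, LinearMap.smul_apply, Module.End.mul_apply,
    Module.End.one_apply, h.K_apply hK hu, map_smul, h1, map_add, h2, qRacahEigenvalue_eq]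
  match_scalars <;> field_simp <;> ring

/-- A map that satisfies the `q`-Weyl relation of `B` with `A` and agrees with `B` on every `K_i` is
`B`. -/
theorem IsQRacah.isB_of_qWeyl [FiniteDimensional 𝕂 V] (h : Φ.IsQRacah q a b) {X : Module.End 𝕂 V}
    (hX : q • (X * Φ.A) - q⁻¹ • (Φ.A * X) = (q - q⁻¹) • (a⁻¹ • (X * X) + a • 1))
    (hKX : ∀ i : Fin (d + 1), 2 * (i : ℕ) ≤ d → ∀ v ∈ Φ.Ksub i,
      X v = q ^ ((d : ℤ) - 2 * (i : ℤ)) • v) : Φ.IsB q X := by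
  have hq := h.q_ne_zero
  obtain ⟨B, hB⟩ := h.dd.exists_isK
  have hBK := (hB B).2 rfl
  rw [h.isB_iff_isK_dd, hB]
  let N : Submodule 𝕂 V := LinearMap.eqLocus X B
  suffices hN : N = ⊤ from LinearMap.ext fun v => (hN ▸ Submodule.mem_top : v ∈ N)
  refine h.dd.eq_top_of_Ksub_le (fun i hi v hv => ?_) (fun k u hu huN => ?_)
  · have h1 := (h.dd.mem_Ksub i).1 hv
    have h2 : v ∈ Φ.Ksub i := by
      rw [h.mem_Ksub]
      refine ⟨⟨h1.1.1, ?_⟩, h1.1.2⟩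
      have h3 := mem_hi_dd.1 h1.2
      exact mem_hi.2 fun j hj => by
        have := h3 j.rev (by rw [Fin.val_rev]; omega)
        simpa [TDSystem.dd] using this
    exact (hKX i hi v h2).trans (h.dd.K_apply hBK h1.1).symm
  · have h1 := h.dd.sub_smul_mem_inf hu
    have h2 : Φ.dd.A u - qRacahEigenvalue d q a⁻¹ k • u ∈ Φ.dd.split (k + 1) := h1
    refine LinearMap.mem_eqLocus.2 (Eq.trans ?_ (h.dd.K_apply hBK h2).symm)
    have hXu : X u = q ^ ((d : ℤ) - 2 * (k : ℤ)) • u :=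
      (LinearMap.mem_eqLocus.1 huN).trans (h.dd.K_apply hBK hu)
    have h4 : q ^ ((d : ℤ) - 2 * (k : ℤ)) ≠ 0 := zpow_ne_zero _ hq
    have h5 := LinearMap.congr_fun hX u
    simp only [LinearMap.sub_apply, LinearMap.add_apply, LinearMap.smul_apply,
      Module.End.mul_apply, Module.End.one_apply, hXu, map_smul] at h5
    have ha := h.a_ne_zero
    have h6 : X (Φ.A u) = q⁻¹ • ((q - q⁻¹) • (a⁻¹ • q ^ ((d : ℤ) - 2 * (k : ℤ)) •
        q ^ ((d : ℤ) - 2 * (k : ℤ)) • u + a • u) +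
          q⁻¹ • q ^ ((d : ℤ) - 2 * (k : ℤ)) • Φ.A u) := by
      rw [← h5, sub_add_cancel, smul_smul, inv_mul_cancel₀ hq, one_smul]
    change X (Φ.A u - qRacahEigenvalue d q a⁻¹ k • u) =
      q ^ ((d : ℤ) - 2 * ((k + 1 : ℕ) : ℤ)) • (Φ.A u - qRacahEigenvalue d q a⁻¹ k • u)
    rw [zpow_sub_two_mul_succ hq, map_sub, map_smul, hXu, h6, qRacahEigenvalue_eq, inv_inv]
    match_scalars <;> field_simp <;> ring

end Comparison

end TDSystem

/-! ### Inverses of polynomials in a nilpotent element -/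

theorem isUnit_one_sub_smul_of_pow_eq_zero {𝕂 𝒜 : Type*} [Field 𝕂] [Ring 𝒜] [Algebra 𝕂 𝒜] {ψ : 𝒜}
    {n : ℕ} (hψ : ψ ^ n = 0) (c : 𝕂) : IsUnit (1 - c • ψ) :=
  IsNilpotent.isUnit_one_sub ⟨n, by rw [smul_pow, hψ, smul_zero]⟩

theorem exists_aeval_eq_mul_inverse {𝕂 𝒜 : Type*} [Field 𝕂] [Ring 𝒜] [Algebra 𝕂 𝒜] {ψ : 𝒜} {n : ℕ}
    (hψ : ψ ^ n = 0) (c e : 𝕂) :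
    ∃ p : Polynomial 𝕂, (1 - c • ψ) * Ring.inverse (1 - e • ψ) = Polynomial.aeval ψ p := by
  have hu := isUnit_one_sub_smul_of_pow_eq_zero hψ e
  have h1 : Ring.inverse (1 - e • ψ) = ∑ i ∈ Finset.range n, (e • ψ) ^ i := by
    have h2 : (1 - e • ψ) * ∑ i ∈ Finset.range n, (e • ψ) ^ i = 1 := by
      rw [mul_neg_geom_sum, smul_pow, hψ, smul_zero, sub_zero]
    exact left_inv_eq_right_inv (Ring.inverse_mul_cancel _ hu) h2
  refine ⟨(1 - Polynomial.C c * Polynomial.X) *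
    ∑ i ∈ Finset.range n, (Polynomial.C e * Polynomial.X) ^ i, ?_⟩
  rw [h1]
  simp [Algebra.smul_def]

/-! ### The formulas -/

theorem theorem9p4 {𝕂 V : Type*} [Field 𝕂] [IsAlgClosed 𝕂] [AddCommGroup V] [Module 𝕂 V]
    [FiniteDimensional 𝕂 V] [Nontrivial V] {d : ℕ} (hd : 1 ≤ d)
    (Φ : TDSystem 𝕂 V d) (q a b : 𝕂) (hΦ : Φ.IsQRacah q a b) :
    ∃ (K B : (Module.End 𝕂 V)ˣ) (ψ : Module.End 𝕂 V),
      -- `K`, `B`, `ψ` exist, and each is determined by its defining property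
      (∀ X : Module.End 𝕂 V, Φ.IsK q X ↔ X = K) ∧
      (∀ X : Module.End 𝕂 V, Φ.IsB q X ↔ X = B) ∧
      (∀ X : Module.End 𝕂 V, Φ.IsPsi q a K X ↔ X = ψ) ∧
      -- `ψ` is nilpotent
      ψ ^ (d + 1) = 0 ∧
      -- the denominators are invertible
      IsUnit (1 - (a * q) • ψ) ∧ IsUnit (1 - (a⁻¹ * q) • ψ) ∧
      IsUnit (1 - (a * q⁻¹) • ψ) ∧ IsUnit (1 - (a⁻¹ * q⁻¹) • ψ) ∧
      -- the four formulas
      (B * K⁻¹ : Module.End 𝕂 V) =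
        (1 - (a * q) • ψ) * Ring.inverse (1 - (a⁻¹ * q) • ψ) ∧
      (K * B⁻¹ : Module.End 𝕂 V) =
        (1 - (a⁻¹ * q) • ψ) * Ring.inverse (1 - (a * q) • ψ) ∧
      (K⁻¹ * B : Module.End 𝕂 V) =
        (1 - (a * q⁻¹) • ψ) * Ring.inverse (1 - (a⁻¹ * q⁻¹) • ψ) ∧
      (B⁻¹ * K : Module.End 𝕂 V) =
        (1 - (a⁻¹ * q⁻¹) • ψ) * Ring.inverse (1 - (a * q⁻¹) • ψ) ∧
      -- each of the four maps is a polynomial in `ψ`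
      (∃ p : Polynomial 𝕂, (B * K⁻¹ : Module.End 𝕂 V) = Polynomial.aeval ψ p) ∧
      (∃ p : Polynomial 𝕂, (K * B⁻¹ : Module.End 𝕂 V) = Polynomial.aeval ψ p) ∧
      (∃ p : Polynomial 𝕂, (K⁻¹ * B : Module.End 𝕂 V) = Polynomial.aeval ψ p) ∧
      (∃ p : Polynomial 𝕂, (B⁻¹ * K : Module.End 𝕂 V) = Polynomial.aeval ψ p) := by
  obtain ⟨K, hK⟩ := hΦ.exists_isK
  have hKK := (hK K).2 rfl
  obtain ⟨ψ, hψ, hKψ, hnil⟩ := hΦ.exists_psi hKK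
  obtain ⟨B, hB⟩ := hΦ.dd.exists_isK
  have hB' : ∀ X : Module.End 𝕂 V, Φ.IsB q X ↔ X = B := fun X =>
    hΦ.isB_iff_isK_dd.trans (hB X)
  have hq := hΦ.q_ne_zero
  have hψK := (hψ ψ).2 rfl
  have unit := isUnit_one_sub_smul_of_pow_eq_zero (𝕂 := 𝕂) hnil
  have hcomm : ∀ c e : 𝕂, Commute (1 - c • ψ) (1 - e • ψ) := fun c e =>
    ((Commute.one_left _).sub_left
      (((Commute.one_right ψ).sub_right ((Commute.refl ψ).smul_right e)).smul_left c))
  -- `B` is `(1 - a q ψ)(1 - a⁻¹ q ψ)⁻¹ K`: both satisfy the same relation with `A`, and they agree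
  -- on the `K_i`, where `ψ` vanishes
  have hBeq : (1 - (a * q) • ψ) * Ring.inverse (1 - (a⁻¹ * q) • ψ) * (K : Module.End 𝕂 V) = B := by
    refine (hB' _).1 (hΦ.isB_of_qWeyl ?_ fun i hi v hv => ?_)
    · exact qWeyl_of_psi hq hΦ.a_ne_zero K.mul_inv K.inv_mul (hΦ.qWeyl_K hKK) hKψ hψK.1
        (Ring.inverse_mul_cancel _ (unit _)) (Ring.mul_inverse_cancel _ (unit _))
    · have h1 : ψ v = 0 := hψK.2 i hi v hv
      have h2 : Ring.inverse (1 - (a⁻¹ * q) • ψ) v = v := by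
        have h3 := LinearMap.congr_fun (Ring.inverse_mul_cancel _ (unit (a⁻¹ * q))) v
        simpa [h1] using h3
      rw [Module.End.mul_apply, hΦ.K_apply hKK ((hΦ.mem_Ksub i).1 hv).1, map_smul,
        Module.End.mul_apply, h2]
      simp [h1]
  -- conjugation by `K` replaces `q` by `q⁻¹` in the factors
  have hconj : ∀ c : 𝕂, (1 - (c * q) • ψ) * (K : Module.End 𝕂 V) =
      K * (1 - (c * q⁻¹) • ψ) := by
    intro c
    rw [mul_sub, sub_mul, mul_smul_comm, hKψ, smul_smul, smul_mul_assoc, one_mul, mul_one]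
    congr 2
    field_simp
  have hconj' : ∀ c : 𝕂, Ring.inverse (1 - (c * q) • ψ) * (K : Module.End 𝕂 V) =
      K * Ring.inverse (1 - (c * q⁻¹) • ψ) := by
    intro c
    have h1 := congrArg (fun T => Ring.inverse (1 - (c * q) • ψ) * T *
      Ring.inverse (1 - (c * q⁻¹) • ψ)) (hconj c)
    rw [← mul_assoc, Ring.inverse_mul_cancel _ (unit _), one_mul, ← mul_assoc,
      mul_assoc _ _ (Ring.inverse (1 - (c * q⁻¹) • ψ)), Ring.mul_inverse_cancel _ (unit _),
      mul_one] at h1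
    exact h1.symm
  have hinv : ∀ c e : 𝕂, (1 - c • ψ) * Ring.inverse (1 - e • ψ) *
      ((1 - e • ψ) * Ring.inverse (1 - c • ψ)) = 1 := by
    intro c e
    rw [mul_assoc, ← mul_assoc (Ring.inverse (1 - e • ψ)), Ring.inverse_mul_cancel _ (unit _),
      one_mul, Ring.mul_inverse_cancel _ (unit _)]
  have f1 : (B * K⁻¹ : Module.End 𝕂 V) =
      (1 - (a * q) • ψ) * Ring.inverse (1 - (a⁻¹ * q) • ψ) := by
    rw [← hBeq, mul_assoc, Units.mul_inv, mul_one]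
  have f3 : (K⁻¹ * B : Module.End 𝕂 V) =
      (1 - (a * q⁻¹) • ψ) * Ring.inverse (1 - (a⁻¹ * q⁻¹) • ψ) := by
    rw [← hBeq, mul_assoc _ _ (K : Module.End 𝕂 V), hconj', ← mul_assoc _ (K : Module.End 𝕂 V),
      hconj, ← mul_assoc, ← mul_assoc, Units.inv_mul, one_mul]
  have f2 : (K * B⁻¹ : Module.End 𝕂 V) =
      (1 - (a⁻¹ * q) • ψ) * Ring.inverse (1 - (a * q) • ψ) := by
    refine left_inv_eq_right_inv (a := (B * K⁻¹ : Module.End 𝕂 V)) ?_ (f1 ▸ hinv _ _)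
    rw [mul_assoc, ← mul_assoc _ (B : Module.End 𝕂 V), Units.inv_mul, one_mul, Units.mul_inv]
  have f4 : (B⁻¹ * K : Module.End 𝕂 V) =
      (1 - (a⁻¹ * q⁻¹) • ψ) * Ring.inverse (1 - (a * q⁻¹) • ψ) := by
    refine left_inv_eq_right_inv (a := (K⁻¹ * B : Module.End 𝕂 V)) ?_ (f3 ▸ hinv _ _)
    rw [mul_assoc, ← mul_assoc _ _ (B : Module.End 𝕂 V), Units.mul_inv, one_mul, Units.inv_mul]
  refine ⟨K, B, ψ, hK, hB', hψ, hnil, unit _, unit _, unit _, unit _, f1, f2, f3, f4, ?_, ?_, ?_, ?_⟩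
  · rw [f1]; exact exists_aeval_eq_mul_inverse hnil _ _
  · rw [f2]; exact exists_aeval_eq_mul_inverse hnil _ _
  · rw [f3]; exact exists_aeval_eq_mul_inverse hnil _ _
  · rw [f4]; exact exists_aeval_eq_mul_inverse hnil _ _
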